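/- Two strings $S$ and $T$ of the same length $l$ over a (totally) ordered alphabet are *order-isomorphic*, $S\approx T$, if $S[i]\le S[j]\iff T[i]\le T[j]$ for all $1\le i,j\le l$. For strings $S_1,S_2$ and indices $1\le i_1\le |S_1|$, $1\le i_2\le |S_2|$, the *op-LCE query* $(i_1,i_2)$ asks for the largest $l$ such that the substrings of length $l$ of $S_1$ and $S_2$ that begin at $i_1$ and $i_2$ exist and are order-isomorphic. The *order-preserving Z-table* of a string $S$ has as its entry at $k$, $1\le k\le |S|$, the largest $l$ such that the prefix of length $l$ of $S$ is order-isomorphic to the substring of length $l$ of $S$ that begins at $k$. The model is a word RAM on which the characters of the (read-only) input can only be compared with each other, in constant time, so that the programs and constants work for every ordered alphabet; the space is the number of memory cells used, and a word has $O(\log(|S_1|+|S_2|))$ (respectively $O(\log |S|)$) bits, up to an additive constant. **Lemma.** (1) For nonempty strings $S_1,S_2$, after a preprocessing that takes $O(|S_1||S_2|)$ time, every op-LCE query on $S_1$ and $S_2$ can be answered in $O(1)$ time; the preprocessing and the queries use $O(|S_1||S_2|)$ space. (2) The order-preserving Z-tables of all suffixes of a nonempty string $S$ (in particular of $S=S_1\cdot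 S_2$) can be computed in $O(|S|^2)$ total time. -/

import Mathlib

namespace OpLCE

section Strings

variable {α : Type*} [LinearOrder α]

/-- Two strings over an ordered alphabet are order-isomorphic: they have the same length, and
`S[i] ≤ S[j] ↔ T[i] ≤ T[j]` for all positions `i`, `j`. -/
def OrderIsomorphic (S T : List α) : Prop :=
  ∃ h : S.length = T.length, ∀ i j : Fin S.length,
    S.get i ≤ S.get j ↔ T.get (i.cast h) ≤ T.get (j.cast h)

/-- The substring of length `l` that begins at the (1-based) position `i`. It is only used where
`i + l ≤ S.length + 1`, so that it really has length `l`. -/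
def substring (S : List α) (i l : ℕ) : List α :=
  (S.drop (i - 1)).take l

/-- The suffix that begins at the (1-based) position `i`. -/
def suffixFrom (S : List α) (i : ℕ) : List α :=
  S.drop (i - 1)

/-- `v` is the largest `l` such that the substrings of length `l` of `S₁` and `S₂` beginning at
the (1-based) positions `i₁` and `i₂` exist and are order-isomorphic. -/
def IsOpLCE (S₁ S₂ : List α) (i₁ i₂ v : ℕ) : Prop :=
  IsGreatest {l : ℕ | i₁ + l ≤ S₁.length + 1 ∧ i₂ + l ≤ S₂.length + 1 ∧
    OrderIsomorphic (substring S₁ i₁ l) (substring S₂ i₂ l)} v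

/-- `v` is the entry at the (1-based) position `k` of the order-preserving Z-table of `S`: the
largest `l` such that the prefix of length `l` of `S` is order-isomorphic to the substring of
length `l` of `S` beginning at `k`. -/
def IsZEntry (S : List α) (k v : ℕ) : Prop :=
  IsGreatest {l : ℕ | k + l ≤ S.length + 1 ∧
    OrderIsomorphic (substring S 1 l) (substring S k l)} v

end Strings

/-! A word RAM with structured programs. A program works with registers (a program names only
finitely many of them), with a memory that is addressed indirectly, and with a read-only input
string, on which the only operation is the comparison of two characters. `W` bounds the machine
words (every stored value is `< W`) and `M` is the number of memory cells (every address
accessed is `< M`); a program that violates one of the bounds, or that reads a character outside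
the input, has no execution. -/

/-- Elementary operations; the arguments are names of registers, except for the constant `k`. -/
inductive Op where
  /-- `r := k` -/
  | const (r k : ℕ)
  /-- `r := a + b` -/
  | add (r a b : ℕ)
  /-- `r := a - b`, truncated at `0` -/
  | sub (r a b : ℕ)
  /-- `r := a * b` -/
  | mul (r a b : ℕ)
  /-- `r := mem[a]` -/
  | load (r a : ℕ)
  /-- `mem[a] := b` -/
  | store (a b : ℕ)

/-- Tests. -/
inductive Test where
  /-- the value of register `a` is at most that of register `b` -/
  | le (a b : ℕ)
  /-- the input character at the (0-based) position held by register `a` is at most the one at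
  the position held by register `b` -/
  | charLe (a b : ℕ)

/-- Programs. -/
inductive Program where
  | skip
  | op (o : Op)
  | seq (p q : Program)
  | branch (c : Test) (p q : Program)
  | loop (c : Test) (p : Program)

/-- The contents of the registers and of the memory. -/
@[ext]
structure State where
  reg : ℕ → ℕ
  mem : ℕ → ℕ

/-- Write the value `v` to register `r`, provided that it fits into a word. -/
def State.setReg (W : ℕ) (s : State) (r v : ℕ) : Option State :=
  if v < W then some { s with reg := Function.update s.reg r v } else none

/-- Write the value `v` to the memory cell `a`, provided that the cell exists and that the value
fits into a word. -/
def State.setMem (W M : ℕ) (s : State) (a v : ℕ) : Option State :=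
  if a < M ∧ v < W then some { s with mem := Function.update s.mem a v } else none

/-- The effect of an elementary operation. -/
def Op.run (W M : ℕ) (s : State) : Op → Option State
  | .const r k => s.setReg W r k
  | .add r a b => s.setReg W r (s.reg a + s.reg b)
  | .sub r a b => s.setReg W r (s.reg a - s.reg b)
  | .mul r a b => s.setReg W r (s.reg a * s.reg b)
  | .load r a => if s.reg a < M then s.setReg W r (s.mem (s.reg a)) else none
  | .store a b => s.setMem W M (s.reg a) (s.reg b)

/-- The outcome of a test on the input string `S`. -/
def Test.eval {α : Type*} [LinearOrder α] (S : List α) (s : State) : Test → Option Bool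
  | .le a b => some (decide (s.reg a ≤ s.reg b))
  | .charLe a b =>
    match S[s.reg a]?, S[s.reg b]? with
    | some x, some y => some (decide (x ≤ y))
    | _, _ => none

/-- `Exec S W M p s t s'`: on the input string `S`, with word bound `W` and `M` memory cells,
the program `p` started in the state `s` halts after exactly `t` steps in the state `s'`. Each
elementary operation and each evaluation of a test is one step. -/
inductive Exec {α : Type*} [LinearOrder α] (S : List α) (W M : ℕ) :
    Program → State → ℕ → State → Prop
  | skip (s : State) : Exec S W M .skip s 0 s
  | op {o : Op} {s s' : State} (h : o.run W M s = some s') : Exec S W M (.op o) s 1 s'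
  | seq {p q : Program} {s s' s'' : State} {t t' : ℕ} (hp : Exec S W M p s t s')
      (hq : Exec S W M q s' t' s'') : Exec S W M (.seq p q) s (t + t') s''
  | branchTrue {c : Test} {p q : Program} {s s' : State} {t : ℕ} (hc : c.eval S s = some true)
      (hp : Exec S W M p s t s') : Exec S W M (.branch c p q) s (t + 1) s'
  | branchFalse {c : Test} {p q : Program} {s s' : State} {t : ℕ} (hc : c.eval S s = some false)
      (hq : Exec S W M q s t s') : Exec S W M (.branch c p q) s (t + 1) s'
  | loopTrue {c : Test} {p : Program} {s s' s'' : State} {t t' : ℕ}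
      (hc : c.eval S s = some true) (hp : Exec S W M p s t s')
      (hl : Exec S W M (.loop c p) s' t' s'') : Exec S W M (.loop c p) s (t + t' + 1) s''
  | loopFalse {c : Test} {p : Program} {s : State} (hc : c.eval S s = some false) :
      Exec S W M (.loop c p) s 1 s

/-- The state in which registers `0` and `1` hold `a` and `b`, all other registers hold `0`, and
the memory is `mem`. -/
def startState (a b : ℕ) (mem : ℕ → ℕ) : State where
  reg r := if r = 0 then a else if r = 1 then b else 0
  mem := mem

end OpLCE

/-! Suppose that two windows are order-isomorphic and that each is extended by one position. Let p
hold a greatest character of the first window that is not above the new one, and q a least one that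
is not below it. The extended windows are order-isomorphic iff the new characters compare alike with
p, q and with their counterparts (`Iso.succ_iff`): the order between the new character and any other
one is forced through p or q. Once p and q are tabulated for every window, an extension test takes
constant time.

For a fixed end k, growing the window to the left changes p or q only if the added position takes
over (`Closest.replace`, `Closest.keep`), so each table entry costs constant time. Only windows with
end below n₁ and length below n₂ are needed, at most n₁ n₂ of them.

The answers are computed along the diagonals (i, j), (i + 1, j + 1), …. Deleting the first
characters of isomorphic windows leaves isomorphic windows (`Iso.tail`), so the answer drops by at
most one from pair to pair. Each step of the sweep extends the current windows or advances to the
next pair, and either decreases twice the remaining length minus the current length. A diagonal thus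
costs time linear in its length, and all of them together O(n₁ n₂).

Queries use this on the concatenation of the strings, with the second one at offset n₁. A Z-table
entry at k of the suffix at i is the answer for the string against itself at i and i + k - 1, so the
diagonals on and above the main one suffice. Loop-free code is verified by weakest preconditions
(`Runs.of_wp`), loops by invariants with a decreasing measure (`Runs.loop`). -/

namespace OpLCE

/-! ### Bounded-time correctness of programs -/

/-- Write `v` to register `r`. -/
def State.set (s : State) (r v : ℕ) : State := { s with reg := Function.update s.reg r v }

/-- Write `v` to the memory cell `a`. -/
def State.put (s : State) (a v : ℕ) : State := { s with mem := Function.update s.mem a v }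

@[simp] theorem State.reg_set (s : State) (r v x : ℕ) :
    (s.set r v).reg x = if x = r then v else s.reg x := by
  simp [State.set, Function.update_apply]

@[simp] theorem State.mem_set (s : State) (r v : ℕ) : (s.set r v).mem = s.mem := rfl

@[simp] theorem State.reg_put (s : State) (a v : ℕ) : (s.put a v).reg = s.reg := rfl

@[simp] theorem State.mem_put (s : State) (a v x : ℕ) :
    (s.put a v).mem x = if x = a then v else s.mem x := by
  simp [State.put, Function.update_apply]

/-- On input `S`, the program `p` started in `s` halts within `B` steps in a state that
satisfies `Q`. -/
def Runs {α : Type*} [LinearOrder α] (S : List α) (W : ℕ) (p : Program) (s : State) (B : ℕ)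
    (Q : State → Prop) : Prop :=
  ∃ t s', t ≤ B ∧ Exec S W W p s t s' ∧ Q s'

/-- The number of steps of a loop-free program is at most its cost. -/
def Program.cost : Program → ℕ
  | .skip => 0
  | .op _ => 1
  | .seq p q => p.cost + q.cost
  | .branch _ p q => max p.cost q.cost + 1
  | .loop _ _ => 0

/-- The weakest precondition of a loop-free program on an input of length `len` with
characters `f 0, f 1, …`. -/
def wp {α : Type*} [LinearOrder α] (f : ℕ → α) (len W : ℕ) :
    Program → (State → Prop) → State → Prop
  | .skip, Q, s => Q s
  | .op (.const r k), Q, s => k < W ∧ Q (s.set r k)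
  | .op (.add r a b), Q, s => s.reg a + s.reg b < W ∧ Q (s.set r (s.reg a + s.reg b))
  | .op (.sub r a b), Q, s => s.reg a - s.reg b < W ∧ Q (s.set r (s.reg a - s.reg b))
  | .op (.mul r a b), Q, s => s.reg a * s.reg b < W ∧ Q (s.set r (s.reg a * s.reg b))
  | .op (.load r a), Q, s => s.reg a < W ∧ s.mem (s.reg a) < W ∧ Q (s.set r (s.mem (s.reg a)))
  | .op (.store a b), Q, s => s.reg a < W ∧ s.reg b < W ∧ Q (s.put (s.reg a) (s.reg b))
  | .seq p q, Q, s => wp f len W p (wp f len W q Q) s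
  | .branch (.le a b) p q, Q, s =>
      (s.reg a ≤ s.reg b → wp f len W p Q s) ∧ (¬ s.reg a ≤ s.reg b → wp f len W q Q s)
  | .branch (.charLe a b) p q, Q, s =>
      s.reg a < len ∧ s.reg b < len ∧ (f (s.reg a) ≤ f (s.reg b) → wp f len W p Q s) ∧
        (¬ f (s.reg a) ≤ f (s.reg b) → wp f len W q Q s)
  | .loop _ _, _, _ => False

section Logic

variable {α : Type*} [LinearOrder α] {S : List α} {W : ℕ}

theorem Runs.mono {p : Program} {s : State} {B B' : ℕ} {Q Q' : State → Prop}
    (h : Runs S W p s B Q) (hB : B ≤ B') (hQ : ∀ s', Q s' → Q' s') : Runs S W p s B' Q' := by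
  obtain ⟨t, s', h1, h2, h3⟩ := h
  exact ⟨t, s', h1.trans hB, h2, hQ _ h3⟩

theorem Runs.seq {p q : Program} {s : State} {B B' : ℕ} {R Q : State → Prop}
    (hp : Runs S W p s B R) (hq : ∀ s', R s' → Runs S W q s' B' Q) :
    Runs S W (.seq p q) s (B + B') Q := by
  obtain ⟨t, s', h1, h2, h3⟩ := hp
  obtain ⟨t', s'', h4, h5, h6⟩ := hq s' h3
  exact ⟨t + t', s'', add_le_add h1 h4, .seq h2 h5, h6⟩

theorem Runs.op {o : Op} {s s' : State} {Q : State → Prop} (h : o.run W W s = some s')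
    (hQ : Q s') : Runs S W (.op o) s 1 Q :=
  ⟨1, s', le_rfl, .op h, hQ⟩

theorem Runs.branch {c : Test} {p q : Program} {s : State} {B : ℕ} {Q : State → Prop} (b : Bool)
    (hc : c.eval S s = some b) (h : Runs S W (if b then p else q) s B Q) :
    Runs S W (.branch c p q) s (B + 1) Q := by
  obtain ⟨t, s', h1, h2, h3⟩ := h
  cases b
  · exact ⟨t + 1, s', by omega, .branchFalse hc h2, h3⟩
  · exact ⟨t + 1, s', by omega, .branchTrue hc h2, h3⟩

/-- A loop whose test reads `a ≤ b` and whose body decreases a measure. -/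
theorem Runs.loop {a b : ℕ} {p : Program} {B : ℕ} {Q : State → Prop} (I : ℕ → State → Prop)
    (hstep : ∀ m s, I m s → s.reg a ≤ s.reg b →
      Runs S W p s B (fun s' => ∃ m' < m, I m' s'))
    (hend : ∀ m s, I m s → ¬ s.reg a ≤ s.reg b → Q s) :
    ∀ m s, I m s → Runs S W (.loop (.le a b) p) s ((B + 1) * m + 1) Q := by
  intro m
  induction m using Nat.strong_induction_on with
  | _ m ih =>
    intro s hs
    by_cases hc : s.reg a ≤ s.reg b
    · obtain ⟨t, s', h1, h2, m', hm, h3⟩ := hstep m s hs hc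
      obtain ⟨t', s'', h4, h5, h6⟩ := ih m' hm s' h3
      refine ⟨t + t' + 1, s'', ?_, .loopTrue (by simp [Test.eval, hc]) h2 h5, h6⟩
      -- The decrease of the measure by at least one pays for the body and one test.
      have := Nat.mul_le_mul_left (B + 1) (Nat.succ_le_of_lt hm)
      rw [Nat.succ_eq_add_one, Nat.mul_add] at this
      omega
    · exact ⟨1, s, by omega, .loopFalse (by simp [Test.eval, hc]), hend m s hs hc⟩

/-- Structural induction. Loops are excluded because their precondition is `False`. -/
theorem Runs.of_wp {f : ℕ → α} (hf : ∀ i < S.length, S[i]? = some (f i)) {p : Program}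
    {Q : State → Prop} {s : State} (h : wp f S.length W p Q s) : Runs S W p s p.cost Q := by
  induction p generalizing s Q with
  | skip => exact ⟨0, s, le_rfl, .skip s, h⟩
  | op o =>
    cases o with
    | const r k => exact .op (by simp [Op.run, State.setReg, h.1, State.set]) h.2
    | add r a b => exact .op (by simp [Op.run, State.setReg, h.1, State.set]) h.2
    | sub r a b => exact .op (by simp [Op.run, State.setReg, h.1, State.set]) h.2
    | mul r a b => exact .op (by simp [Op.run, State.setReg, h.1, State.set]) h.2
    | load r a => exact .op (by simp [Op.run, State.setReg, h.1, h.2.1, State.set]) h.2.2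
    | store a b => exact .op (by simp [Op.run, State.setMem, h.1, h.2.1, State.put]) h.2.2
  | seq p q hp hq => exact (hp h).seq fun s' hs' => hq hs'
  | branch c p q hp hq =>
    cases c with
    | le a b =>
      by_cases hc : s.reg a ≤ s.reg b
      · exact .branch true (by simp [Test.eval, hc])
          ((hp (h.1 hc)).mono (le_max_left _ _) fun _ => id)
      · exact .branch false (by simp [Test.eval, hc])
          ((hq (h.2 hc)).mono (le_max_right _ _) fun _ => id)
    | charLe a b =>
      obtain ⟨ha, hb, h1, h2⟩ := h
      by_cases hc : f (s.reg a) ≤ f (s.reg b)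
      · exact .branch true (by simp only [Test.eval, hf _ ha, hf _ hb, hc, decide_true])
          ((hp (h1 hc)).mono (le_max_left _ _) fun _ => id)
      · exact .branch false (by simp only [Test.eval, hf _ ha, hf _ hb, hc, decide_false])
          ((hq (h2 hc)).mono (le_max_right _ _) fun _ => id)
  | loop c p => exact h.elim

end Logic

/-! ### Windows of a sequence of characters -/

section Windows

variable {α : Type*}

/-- Among the positions `j ∈ [a, k)` with `r (f j) (f k)`, the position `p` is one with an
`r`-greatest character; `p = k` if there is no such `j`. -/
def Closest (r : α → α → Prop) (f : ℕ → α) (a k p : ℕ) : Prop :=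
  ((a ≤ p ∧ p < k ∧ r (f p) (f k)) ∨ p = k) ∧
    ∀ j, a ≤ j → j < k → r (f j) (f k) → p < k ∧ r (f j) (f p)

theorem Closest.le {r : α → α → Prop} {f : ℕ → α} {a k p : ℕ} (h : Closest r f a k p) :
    p ≤ k := by
  rcases h.1 with h | h <;> omega

/-- The state before any position has been examined: the default `k` means that there is no
candidate. -/
theorem closest_empty (r : α → α → Prop) (f : ℕ → α) (k : ℕ) : Closest r f (k + 1) k k :=
  ⟨.inr rfl, fun j h1 h2 => by omega⟩

/-- Enlarging the window by a position that becomes the closest one. -/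
theorem Closest.replace {r : α → α → Prop} [IsTrans α r] [Std.Refl r] {f : ℕ → α} {i k p : ℕ}
    (h : Closest r f (i + 1) k p) (hik : i ≤ k) (hr : r (f i) (f k))
    (hp : k ≤ p ∨ r (f p) (f i)) : Closest r f i k i := by
  obtain ⟨h1, h2⟩ := h
  refine ⟨?_, fun j hj hjk hrj => ?_⟩
  · rcases hik.eq_or_lt with h | h
    · exact .inr h
    · exact .inl ⟨le_rfl, h, hr⟩
  · rcases hj.eq_or_lt with rfl | hj
    · exact ⟨hjk, refl _⟩
    · obtain ⟨h3, h4⟩ := h2 j hj hjk hrj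
      exact ⟨by omega, _root_.trans h4 (hp.resolve_left (by omega))⟩

/-- Enlarging the window by a position that does not become the closest one. -/
theorem Closest.keep {r : α → α → Prop} {f : ℕ → α} {i k p : ℕ}
    (h : Closest r f (i + 1) k p) (hp : r (f i) (f k) → p < k ∧ r (f i) (f p)) :
    Closest r f i k p := by
  obtain ⟨h1, h2⟩ := h
  refine ⟨?_, fun j hj hjk hrj => ?_⟩
  · rcases h1 with h | h
    · exact .inl ⟨by omega, h.2⟩
    · exact .inr h
  · rcases hj.eq_or_lt with rfl | hj
    · exact hp hrj
    · exact h2 j hj hjk hrj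

variable [LinearOrder α]

/-- The windows of length `l` at `a` and `b` are order-isomorphic. -/
def Iso (f : ℕ → α) (a b l : ℕ) : Prop :=
  ∀ u v, u < l → v < l → (f (a + u) ≤ f (a + v) ↔ f (b + u) ≤ f (b + v))

theorem Iso.mono {f : ℕ → α} {a b l l' : ℕ} (h : Iso f a b l) (hl : l' ≤ l) : Iso f a b l' :=
  fun u v hu hv => h u v (hu.trans_le hl) (hv.trans_le hl)

/-- This is why the sweep along a diagonal can keep all but one of the matched positions. Truncation
covers `l = 0`. -/
theorem Iso.tail {f : ℕ → α} {a b l : ℕ} (h : Iso f a b l) : Iso f (a + 1) (b + 1) (l - 1) := by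
  intro u v hu hv
  have := h (1 + u) (1 + v) (by omega) (by omega)
  simpa only [← Nat.add_assoc] using this

/-- The characters at `x`, `p` compare like those at `y`, `q`. -/
def SameOrder (f : ℕ → α) (x p y q : ℕ) : Prop :=
  (f p ≤ f x ↔ f q ≤ f y) ∧ (f x ≤ f p ↔ f y ≤ f q)

/-- Order-isomorphic windows can be extended by one position iff the new position compares
alike with its closest predecessor and its closest successor. -/
theorem Iso.succ_iff {f : ℕ → α} {a b l p q : ℕ} (h : Iso f a b l)
    (hp : Closest (· ≤ ·) f a (a + l) p) (hq : Closest (· ≥ ·) f a (a + l) q) :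
    Iso f a b (l + 1) ↔ SameOrder f (a + l) p (b + l) (p - a + b) ∧
      SameOrder f (a + l) q (b + l) (q - a + b) := by
  obtain ⟨p, rfl⟩ : ∃ p', p = a + p' := ⟨p - a, by rcases hp.1 with h | h <;> omega⟩
  obtain ⟨q, rfl⟩ : ∃ q', q = a + q' := ⟨q - a, by rcases hq.1 with h | h <;> omega⟩
  have ep : a + p - a + b = b + p := by omega
  have eq : a + q - a + b = b + q := by omega
  rw [ep, eq]
  have hpl : p ≤ l := by have := hp.le; omega
  have hql : q ≤ l := by have := hq.le; omega
  constructor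
  · intro h'
    exact ⟨⟨h' p l (by omega) (by omega), h' l p (by omega) (by omega)⟩,
      ⟨h' q l (by omega) (by omega), h' l q (by omega) (by omega)⟩⟩
  · rintro ⟨⟨p1, p2⟩, q1, q2⟩
    -- A position `j` not above the new one lies at or below `p`, one not below it lies at or above
    -- `q`. The isomorphism carries these relations over to `b`, where `p` and `q` compare with the
    -- new position as they do at `a`.
    have key : ∀ j < l, (f (a + j) ≤ f (a + l) ↔ f (b + j) ≤ f (b + l)) ∧
        (f (a + l) ≤ f (a + j) ↔ f (b + l) ≤ f (b + j)) := by
      intro j hj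
      have P := hp.2 (a + j) (by omega) (by omega)
      have Q := hq.2 (a + j) (by omega) (by omega)
      have P1 : p < l → f (a + p) ≤ f (a + l) := by
        intro h; rcases hp.1 with h' | h'
        · exact h'.2.2
        · omega
      have Q1 : q < l → f (a + l) ≤ f (a + q) := by
        intro h; rcases hq.1 with h' | h'
        · exact h'.2.2
        · omega
      have P' : f (a + j) ≤ f (a + l) → p < l ∧ f (a + j) ≤ f (a + p) :=
        fun h => ⟨by have := (P h).1; omega, (P h).2⟩
      have Q' : f (a + l) ≤ f (a + j) → q < l ∧ f (a + q) ≤ f (a + j) :=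
        fun h => ⟨by have := (Q h).1; omega, (Q h).2⟩
      clear P Q hp hq
      have hjp := fun hp' : p < l => h j p hj hp'
      have hpj := fun hp' : p < l => h p j hp' hj
      have hjq := fun hq' : q < l => h j q hj hq'
      have hqj := fun hq' : q < l => h q j hq' hj
      grind
    intro u v hu hv
    rcases Nat.lt_succ_iff_lt_or_eq.1 hu with hu | rfl
    · rcases Nat.lt_succ_iff_lt_or_eq.1 hv with hv | rfl
      · exact h u v hu hv
      · exact (key u hu).1
    · rcases Nat.lt_succ_iff_lt_or_eq.1 hv with hv | rfl
      · exact (key v hv).2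
      · simp

/-- `v` is the greatest length of order-isomorphic windows at `i` and `off + j` that end by
`n₁` and `off + n₂`. -/
def IsLCE (f : ℕ → α) (n₁ n₂ off i j v : ℕ) : Prop :=
  (i + v ≤ n₁ ∧ j + v ≤ n₂ ∧ Iso f i (off + j) v) ∧
    ¬ (i + v < n₁ ∧ j + v < n₂ ∧ Iso f i (off + j) (v + 1))

/-- Failure at `v + 1` excludes all greater lengths, since isomorphism passes to shorter windows. -/
theorem IsLCE.isGreatest {f : ℕ → α} {n₁ n₂ off i j v : ℕ} (h : IsLCE f n₁ n₂ off i j v) :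
    IsGreatest {l | i + l ≤ n₁ ∧ j + l ≤ n₂ ∧ Iso f i (off + j) l} v := by
  refine ⟨h.1, fun l ⟨h1, h2, h3⟩ => ?_⟩
  by_contra hl
  exact h.2 ⟨by omega, by omega, h3.mono (by omega)⟩

theorem orderIsomorphic_iff_iso {f : ℕ → α} {A B : List α} {a b l : ℕ} (hA : A.length = l)
    (hB : B.length = l) (hfA : ∀ u < l, A[u]? = some (f (a + u)))
    (hfB : ∀ u < l, B[u]? = some (f (b + u))) : OrderIsomorphic A B ↔ Iso f a b l := by
  have eA : ∀ u (hu : u < A.length), A.get ⟨u, hu⟩ = f (a + u) := fun u hu => by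
    have := hfA u (by omega)
    rw [List.getElem?_eq_getElem hu] at this
    simpa using this
  have eB : ∀ u (hu : u < B.length), B.get ⟨u, hu⟩ = f (b + u) := fun u hu => by
    have := hfB u (by omega)
    rw [List.getElem?_eq_getElem hu] at this
    simpa using this
  constructor
  · rintro ⟨e, h⟩ u v hu hv
    have := h ⟨u, by omega⟩ ⟨v, by omega⟩
    simpa only [eA, eB, Fin.cast_mk] using this
  · refine fun h => ⟨by omega, ?_⟩
    rintro ⟨u, hu⟩ ⟨v, hv⟩
    simpa only [eA, eB, Fin.cast_mk] using h u v (by omega) (by omega)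

end Windows

/-! ### The programs

Registers `0` to `8` hold the parameters described by `Ready`; the programs below do not change
them. -/

/-- `r := a`, provided that register `8` holds `0`. -/
def move (r a : ℕ) : Program := .op (.add r a 8)

/-- Sequential composition of a list of programs. -/
def block : List Program → Program
  | [] => .skip
  | [p] => p
  | p :: ps => .seq p (block ps)

/-- Let position `14` take part in the search for the closest predecessor of position `10`, which
is kept in register `12`. -/
def updatePred : Program :=
  .branch (.charLe 14 10)
    -- While there is no candidate, register `12` holds the position `10` itself, which this test
    -- detects.
    (.branch (.le 10 12) (move 12 14) (.branch (.charLe 12 14) (move 12 14) .skip)) .skip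

/-- Let position `14` take part in the search for the closest successor of position `10`, which
is kept in register `13`. -/
def updateSucc : Program :=
  .branch (.charLe 10 14)
    (.branch (.le 10 13) (move 13 14) (.branch (.charLe 14 13) (move 13 14) .skip)) .skip

/-- Enter the closest positions for the window of length `11` that ends before position `10`. -/
def closestBody : Program :=
  block [.op (.sub 14 10 11), updatePred, updateSucc,
    .op (.mul 20 14 1), .op (.add 20 20 11), .op (.add 21 20 5), .op (.store 21 12),
    .op (.add 21 20 6), .op (.store 21 13), .op (.add 11 11 7), .op (.sub 15 15 7)]

/-- Prepare the loop over all windows that end before position `10`. -/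
def closestInit : Program :=
  block [move 12 10, move 13 10, .op (.const 11 0), .op (.add 15 10 7),
    .branch (.le 15 1) .skip (move 15 1)]

/-- Advance the outer loop, whose counter is in register `10` and counts up, and whose number of
remaining rounds is in register `16`. -/
def nextRound : Program := .seq (.op (.add 10 10 7)) (.op (.sub 16 16 7))

/-- The tables of closest predecessors and successors. -/
def closestTables : Program :=
  .seq (.seq (.op (.const 10 0)) (move 16 0))
    (.loop (.le 7 16) (.seq (.seq closestInit (.loop (.le 7 15) closestBody)) nextRound))

/-- Put `1` into register `15` unless the two tests on characters agree. -/
def agree (a b c d : ℕ) : Program :=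
  .branch (.charLe a b) (.branch (.charLe c d) .skip (.op (.const 15 1)))
    (.branch (.charLe c d) (.op (.const 15 1)) .skip)

/-- Compare the positions `22` and `24` with the closest positions given by the table that begins
at the address in register `b`. -/
def checkTable (b : ℕ) : Program :=
  block [.op (.add 25 21 b), .op (.load 25 25), .op (.sub 26 25 11), .op (.add 26 26 23),
    agree 25 22 26 24, agree 22 25 24 26]

/-- Can the windows of length `13` be extended? -/
def checkExtension : Program :=
  block [.op (.mul 21 11 1), .op (.add 21 21 13), .op (.add 22 11 13), .op (.add 23 2 12),
    .op (.add 24 23 13), checkTable 5, checkTable 6]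

/-- Write the entry of the current pair of positions and pass to the next pair. -/
def advance : Program :=
  block [.op (.mul 21 11 3), .op (.add 21 21 12), .op (.add 21 21 4), .op (.store 21 13),
    -- The last subtraction truncates, so a length of `0` stays `0`.
    .op (.add 11 11 7), .op (.add 12 12 7), .op (.sub 14 14 7), .op (.sub 13 13 7)]

/-- Extend the current windows by one position if possible, and pass to the next pair of
positions otherwise. -/
def diagonalBody : Program :=
  block [.op (.const 15 0), .op (.add 20 13 7),
    .branch (.le 20 14) checkExtension (.op (.const 15 1)),
    .branch (.le 7 15) advance (move 13 20)]

/-- Prepare the sweep along the diagonal that begins at the positions `11` and `12`. -/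
def diagonalInit : Program :=
  block [.op (.const 13 0), .op (.sub 14 0 11), .op (.sub 20 1 12),
    .branch (.le 14 20) .skip (move 14 20)]

/-- All entries on the diagonal that begins at the positions `11` and `12`. -/
def diagonal : Program := .seq diagonalInit (.loop (.le 7 14) diagonalBody)

/-- The diagonals that begin at the positions `0` and `b`. -/
def upperDiagonals : Program :=
  .seq (.seq (.op (.const 10 0)) (move 16 1))
    (.loop (.le 7 16)
      (.seq (.seq (.seq (.op (.const 11 0)) (move 12 10)) diagonal) nextRound))

/-- The diagonals that begin at the positions `a` and `0`. -/
def lowerDiagonals : Program :=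
  .seq (.seq (.op (.const 10 0)) (move 16 0))
    (.loop (.le 7 16)
      (.seq (.seq (.seq (move 11 10) (.op (.const 12 0))) diagonal) nextRound))

/-- The preprocessing for op-LCE queries. -/
def lcePreprocessing : Program :=
  .seq (block [.op (.const 7 1), .op (.const 8 0), move 2 0, move 3 1, .op (.const 4 1),
      -- The final store saves n₂ in cell `0`, because a query starts with nothing but its two
      -- indices in registers.
      .op (.mul 5 0 1), .op (.add 6 5 5), .op (.add 5 5 7), .op (.add 6 6 7), .op (.store 8 1)])
    (.seq closestTables (.seq upperDiagonals lowerDiagonals))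

/-- An op-LCE query. -/
def lceQuery : Program :=
  block [.op (.const 7 1), .op (.const 8 0), .op (.load 2 8), .op (.sub 0 0 7),
    .op (.sub 1 1 7), .op (.mul 0 0 2), .op (.add 0 0 1), .op (.add 0 0 7), .op (.load 0 0)]

/-- The Z-tables of all suffixes. -/
def zTables : Program :=
  -- The stride n - 1 in register `3` turns the address of the pair (i, j) into i n + (j - i), as
  -- the output format demands.
  .seq (block [.op (.const 7 1), .op (.const 8 0), move 1 0, .op (.const 2 0), .op (.sub 3 0 7),
      .op (.const 4 0), .op (.mul 5 0 1), .op (.add 6 5 5), .op (.add 5 5 7), .op (.add 6 6 7)])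
    (.seq closestTables upperDiagonals)

/-! ### Correctness -/

/-- The contents of the parameter registers. -/
def Ready (n₁ n₂ off st base : ℕ) (s : State) : Prop :=
  s.reg 0 = n₁ ∧ s.reg 1 = n₂ ∧ s.reg 2 = off ∧ s.reg 3 = st ∧ s.reg 4 = base ∧
    s.reg 5 = n₁ * n₂ + 1 ∧ s.reg 6 = 2 * (n₁ * n₂) + 1 ∧ s.reg 7 = 1 ∧ s.reg 8 = 0

/-- The entry for the pair `(i, j)` with `cell i j` is kept at the address `i * st + j + base`;
the tables of closest positions begin above `n₁ * n₂`. -/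
structure Layout (n₁ n₂ off st base len W : ℕ) (cell : ℕ → ℕ → Prop) : Prop where
  n₁_pos : 0 < n₁
  n₂_pos : 0 < n₂
  n₁_le : n₁ ≤ len
  end_le : off + n₂ ≤ len
  len_le : len ≤ 2 * (n₁ * n₂)
  base_le : base ≤ 1
  -- The three tables end by the address 3 n₁ n₂; the factor leaves slack for all other values.
  bound : 10 * (n₁ * n₂) ≤ W
  cell_le : ∀ i j, cell i j → i * st + j + base ≤ n₁ * n₂
  cell_inj : ∀ i j i' j', cell i j → cell i' j' → i * st + j = i' * st + j' → i = i' ∧ j = j'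

/-- The tables of closest positions are correct at the windows `[i, i + l)` with `D i l`. -/
def Filled {α : Type*} [LinearOrder α] (f : ℕ → α) (n₁ n₂ : ℕ) (D : ℕ → ℕ → Prop)
    (mem : ℕ → ℕ) : Prop :=
  ∀ i l, i + l < n₁ → l < n₂ → D i l →
    Closest (· ≤ ·) f i (i + l) (mem (i * n₂ + l + (n₁ * n₂ + 1))) ∧
    Closest (· ≥ ·) f i (i + l) (mem (i * n₂ + l + (2 * (n₁ * n₂) + 1)))

/-- The entries of the pairs `(i, j)` with `cell i j` and `D i j` are correct. -/
def Computed {α : Type*} [LinearOrder α] (f : ℕ → α) (n₁ n₂ off st base : ℕ)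
    (cell D : ℕ → ℕ → Prop) (mem : ℕ → ℕ) : Prop :=
  ∀ i j, i < n₁ → j < n₂ → cell i j → D i j → IsLCE f n₁ n₂ off i j (mem (i * st + j + base))

theorem mul_add_inj {n i l i' l' : ℕ} (hl : l < n) (hl' : l' < n)
    (h : i * n + l = i' * n + l') : i = i' ∧ l = l' := by
  have h1 : (i * n + l) / n = i := by
    rw [Nat.add_comm, Nat.add_mul_div_right _ _ (by omega), Nat.div_eq_of_lt hl, Nat.zero_add]
  have h2 : (i' * n + l') / n = i' := by
    rw [Nat.add_comm, Nat.add_mul_div_right _ _ (by omega), Nat.div_eq_of_lt hl', Nat.zero_add]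
  have : i = i' := by rw [← h1, ← h2, h]
  subst this
  exact ⟨rfl, by omega⟩

theorem mul_add_lt {n m i l : ℕ} (hi : i < m) (hl : l < n) : i * n + l < m * n := by
  have := Nat.mul_le_mul_right n (Nat.succ_le_of_lt hi)
  rw [Nat.succ_mul] at this
  omega

/-! ### The tables of closest predecessors and successors. -/

section Correctness

variable {α : Type*} [LinearOrder α] {f : ℕ → α} {n₁ n₂ off st base len W : ℕ}
  {cell : ℕ → ℕ → Prop}

theorem Ready.congr {s s' : State} (h : Ready n₁ n₂ off st base s)
    (hs : ∀ r < 9, s'.reg r = s.reg r) : Ready n₁ n₂ off st base s' := by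
  simpa only [Ready, hs _ (show 0 < 9 by decide), hs _ (show 1 < 9 by decide),
    hs _ (show 2 < 9 by decide), hs _ (show 3 < 9 by decide), hs _ (show 4 < 9 by decide),
    hs _ (show 5 < 9 by decide), hs _ (show 6 < 9 by decide), hs _ (show 7 < 9 by decide),
    hs _ (show 8 < 9 by decide)] using h

theorem wp_updatePred {s : State} {Q : State → Prop} {i k : ℕ} (hW : len ≤ W) (hk : k < len)
    (hik : i ≤ k) (h8 : s.reg 8 = 0) (h10 : s.reg 10 = k) (h14 : s.reg 14 = i)
    (h : Closest (· ≤ ·) f (i + 1) k (s.reg 12))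
    (hQ : ∀ s' : State, s'.mem = s.mem → (∀ r, r ≠ 12 → s'.reg r = s.reg r) →
      Closest (· ≤ ·) f i k (s'.reg 12) → Q s') :
    wp f len W updatePred Q s := by
  have hle := h.le
  have hset : Closest (· ≤ ·) f i k i → Q (s.set 12 i) := fun h' =>
    hQ _ rfl (fun r hr => by simp [hr]) (by simpa using h')
  have hskip : Closest (· ≤ ·) f i k (s.reg 12) → Q s := fun h' => hQ _ rfl (fun _ _ => rfl) h'
  simp only [updatePred, move, wp, h8, h10, h14, Nat.add_zero]
  refine ⟨by omega, hk, fun h1 => ⟨fun h2 => ⟨by omega, hset ?_⟩, fun h2 => ⟨by omega, by omega,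
    fun h3 => ⟨by omega, hset ?_⟩, fun h3 => hskip ?_⟩⟩, fun h1 => hskip ?_⟩
  · exact h.replace hik h1 (.inl h2)
  · exact h.replace hik h1 (.inr h3)
  · exact h.keep fun _ => ⟨by omega, (le_of_not_ge h3)⟩
  · exact h.keep fun h' => absurd h' h1

theorem wp_updateSucc {s : State} {Q : State → Prop} {i k : ℕ} (hW : len ≤ W) (hk : k < len)
    (hik : i ≤ k) (h8 : s.reg 8 = 0) (h10 : s.reg 10 = k) (h14 : s.reg 14 = i)
    (h : Closest (· ≥ ·) f (i + 1) k (s.reg 13))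
    (hQ : ∀ s' : State, s'.mem = s.mem → (∀ r, r ≠ 13 → s'.reg r = s.reg r) →
      Closest (· ≥ ·) f i k (s'.reg 13) → Q s') :
    wp f len W updateSucc Q s := by
  have hle := h.le
  have hset : Closest (· ≥ ·) f i k i → Q (s.set 13 i) := fun h' =>
    hQ _ rfl (fun r hr => by simp [hr]) (by simpa using h')
  have hskip : Closest (· ≥ ·) f i k (s.reg 13) → Q s := fun h' => hQ _ rfl (fun _ _ => rfl) h'
  simp only [updateSucc, move, wp, h8, h10, h14, Nat.add_zero]
  refine ⟨by omega, by omega, fun h1 => ⟨fun h2 => ⟨by omega, hset ?_⟩, fun h2 => ⟨by omega,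
    by omega, fun h3 => ⟨by omega, hset ?_⟩, fun h3 => hskip ?_⟩⟩, fun h1 => hskip ?_⟩
  · exact h.replace hik h1 (.inl h2)
  · exact h.replace hik h1 (.inr h3)
  · exact h.keep fun _ => ⟨by omega, (le_of_not_ge h3)⟩
  · exact h.keep fun h' => absurd h' h1

/-- The two tables occupy disjoint ranges and row-major addresses are injective, so the cells of all
other windows survive. -/
theorem Filled.put {D D' : ℕ → ℕ → Prop} {mem mem' : ℕ → ℕ} {i l : ℕ}
    (h : Filled f n₁ n₂ D mem) (hi : i + l < n₁) (hl : l < n₂)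
    (hD : ∀ i' l', D' i' l' → D i' l' ∨ i' = i ∧ l' = l)
    (hmem : ∀ x, x ≠ i * n₂ + l + (n₁ * n₂ + 1) → x ≠ i * n₂ + l + (2 * (n₁ * n₂) + 1) →
      mem' x = mem x)
    (hp : Closest (· ≤ ·) f i (i + l) (mem' (i * n₂ + l + (n₁ * n₂ + 1))))
    (hq : Closest (· ≥ ·) f i (i + l) (mem' (i * n₂ + l + (2 * (n₁ * n₂) + 1)))) :
    Filled f n₁ n₂ D' mem' := by
  intro i' l' hi' hl' hD'
  by_cases heq : i' = i ∧ l' = l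
  · rw [heq.1, heq.2]
    exact ⟨hp, hq⟩
  · have h1 := mul_add_lt (show i < n₁ by omega) hl
    have h2 := mul_add_lt (show i' < n₁ by omega) hl'
    have h3 : i' * n₂ + l' ≠ i * n₂ + l := fun h => heq (mul_add_inj hl' hl h)
    rw [hmem _ (by omega) (by omega), hmem _ (by omega) (by omega)]
    exact h i' l' hi' hl' ((hD i' l' hD').resolve_right heq)

/-- The invariant of the loop over all windows that end before `k`. -/
def ClosestInv (f : ℕ → α) (n₁ n₂ off st base : ℕ) (m₀ : ℕ → ℕ) (k c m : ℕ) (s : State) : Prop :=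
  Ready n₁ n₂ off st base s ∧ s.reg 10 = k ∧ s.reg 16 = c ∧ s.reg 15 = m ∧
    -- Register `11` counts the lengths already entered, out of `0, …, min k (n₂ - 1)`; hence the
    -- search has reached back to `k + 1 - s.reg 11`.
    s.reg 11 + m = min (k + 1) n₂ ∧
    Closest (· ≤ ·) f (k + 1 - s.reg 11) k (s.reg 12) ∧
    Closest (· ≥ ·) f (k + 1 - s.reg 11) k (s.reg 13) ∧
    Filled f n₁ n₂ (fun i l => i + l < k ∨ i + l = k ∧ l < s.reg 11) s.mem ∧
    ∀ x < base, s.mem x = m₀ x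

theorem wp_closestBody (hL : Layout n₁ n₂ off st base len W cell) {m₀ : ℕ → ℕ} {k c m : ℕ}
    {s : State} (hk : k < n₁) (hm : 0 < m) (h : ClosestInv f n₁ n₂ off st base m₀ k c m s) :
    wp f len W closestBody (ClosestInv f n₁ n₂ off st base m₀ k c (m - 1)) s := by
  obtain ⟨hr, h10, h16, h15, hl, hp, hq, hf, h0⟩ := h
  obtain ⟨hn₁, hn₂, hn₁', hend, hlen, hbase, hW, -, -⟩ := hL
  have hr' := hr
  obtain ⟨r0, r1, r2, r3, r4, r5, r6, r7, r8⟩ := hr'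
  generalize e11 : s.reg 11 = l at hl hp hq hf
  have hlk : l ≤ k := by omega
  have hln : l < n₂ := by omega
  have e : k + 1 - l = k - l + 1 := by omega
  rw [e] at hp hq
  have hlt := mul_add_lt (show k - l < n₁ by omega) hln
  have hkl : k - l + l = k := by omega
  simp only [closestBody, block, wp, h10, e11]
  refine ⟨by omega, wp_updatePred (i := k - l) (k := k) (by omega) (by omega) (by omega)
    (by simp [r8]) (by simp [h10]) (by simp) (by simpa using hp) ?_⟩
  intro s₁ m1 f1 p1
  refine wp_updateSucc (i := k - l) (k := k) (by omega) (by omega) (by omega)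
    (by simp [f1, r8]) (by simp [f1, h10]) (by simp [f1]) (by simpa [f1] using hq) ?_
  intro s₂ m2 f2 q2
  have e12 : s₂.reg 12 = s₁.reg 12 := f2 _ (by decide)
  rw [← e12] at p1
  have f3 : ∀ r, r ≠ 12 → r ≠ 13 → r ≠ 14 → s₂.reg r = s.reg r := fun r h1 h2 h3 => by
    rw [f2 r h2, f1 r h1]; simp [h3]
  have e14 : s₂.reg 14 = k - l := by rw [f2 _ (by decide), f1 _ (by decide)]; simp
  have em : s₂.mem = s.mem := m2.trans m1
  have hpl := p1.le
  have hql := q2.le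
  simp only [State.reg_set, State.reg_put, f3, ne_eq, not_false_eq_true, e14, r1, r5, r6, r7, h15, e11,
    Nat.reduceEqDiff, if_true, if_false]
  refine ⟨by omega, by omega, by omega, by omega, by omega, by omega, by omega, by omega, by omega,
    by omega, ?_⟩
  refine ⟨hr.congr fun r hr9 => ?_, ?_, ?_, ?_, ?_, ?_, ?_, ?_, ?_⟩
  · have : r ≠ 11 ∧ r ≠ 12 ∧ r ≠ 13 ∧ r ≠ 14 ∧ r ≠ 15 ∧ r ≠ 20 ∧ r ≠ 21 := by omega
    simp [this, f3]
  · simp [f3, h10]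
  · simp [f3, h16]
  · simp
  · simp; omega
  · simpa [show k + 1 - (l + 1) = k - l by omega] using p1
  · simpa [show k + 1 - (l + 1) = k - l by omega] using q2
  · refine hf.put (i := k - l) (l := l) (by omega) hln ?_ ?_ ?_ ?_
    · intro i' l' h
      simp at h
      omega
    · intro x h1 h2
      simp [h1, h2, em]
    -- The store into the successor table must not overwrite the predecessor just written.
    · rw [hkl]; simpa [show n₁ * n₂ ≠ 2 * (n₁ * n₂) by omega] using p1
    · rw [hkl]; simpa using q2
  · intro x hx
    have h1 : x ≠ (k - l) * n₂ + l + (n₁ * n₂ + 1) := by omega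
    have h2 : x ≠ (k - l) * n₂ + l + (2 * (n₁ * n₂) + 1) := by omega
    simpa [h1, h2, em] using h0 x hx

/-- The invariant of the loops over all ends of windows, and over all diagonals. -/
def RoundInv (n₁ n₂ off st base : ℕ) (m₀ : ℕ → ℕ) (n : ℕ) (P : ℕ → (ℕ → ℕ) → Prop)
    (m : ℕ) (s : State) : Prop :=
  Ready n₁ n₂ off st base s ∧ s.reg 16 = m ∧ s.reg 10 + m = n ∧ P (s.reg 10) s.mem ∧
    ∀ x < base, s.mem x = m₀ x

variable {S : List α} (hf : ∀ i < S.length, S[i]? = some (f i))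
include hf

/-- A program that begins with `.const 10 0`, `move 16 r` and repeats a body with `nextRound`. -/
theorem runs_rounds (hL : Layout n₁ n₂ off st base S.length W cell) {r n : ℕ} {m₀ : ℕ → ℕ}
    {P : ℕ → (ℕ → ℕ) → Prop} {body : Program} {B : ℕ} {s : State} (hr : r < 9)
    (hs : Ready n₁ n₂ off st base s) (hrn : s.reg r = n) (hn : n ≤ n₁ * n₂) (hP : P 0 s.mem)
    (hm₀ : ∀ x < base, s.mem x = m₀ x)
    (hbody : ∀ k c s, k < n → Ready n₁ n₂ off st base s → s.reg 16 = c → s.reg 10 = k →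
      P k s.mem → (∀ x < base, s.mem x = m₀ x) →
      Runs S W body s B fun s' => Ready n₁ n₂ off st base s' ∧ s'.reg 16 = c ∧ s'.reg 10 = k ∧
        P (k + 1) s'.mem ∧ ∀ x < base, s'.mem x = m₀ x) :
    Runs S W (.seq (.seq (.op (.const 10 0)) (move 16 r))
      (.loop (.le 7 16) (.seq body nextRound))) s (2 + ((B + 2 + 1) * n + 1))
      fun s' => Ready n₁ n₂ off st base s' ∧ P n s'.mem ∧ ∀ x < base, s'.mem x = m₀ x := by
  have hpos := Nat.mul_pos hL.n₁_pos hL.n₂_pos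
  have hW := hL.bound
  refine Runs.seq (R := RoundInv n₁ n₂ off st base m₀ n P n) (Runs.of_wp hf ?_) ?_
  · obtain ⟨r0, r1, r2, r3, r4, r5, r6, r7, r8⟩ := id hs
    have h10 : r ≠ 10 := by omega
    simp only [wp, move, State.reg_set, h10, hrn, r8, if_false, Nat.add_zero, Nat.reduceEqDiff]
    refine ⟨by omega, by omega, hs.congr fun r hr9 => ?_, ?_, ?_, ?_, ?_⟩
    · have : r ≠ 10 ∧ r ≠ 16 := by omega
      simp [this]
    · simp
    · simp
    · simpa using hP
    · simpa using hm₀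
  · refine Runs.loop (RoundInv n₁ n₂ off st base m₀ n P) ?_ ?_ n
    · rintro m s ⟨hs, h16, h10, hP, hm₀⟩ hc
      have h7 : s.reg 7 = 1 := hs.2.2.2.2.2.2.2.1
      rw [h7, h16] at hc
      refine (hbody (s.reg 10) m s (by omega) hs h16 rfl hP hm₀).seq ?_
      rintro s' ⟨hs', h16', h10', hP', hm₀'⟩
      refine (Runs.of_wp hf (Q := RoundInv n₁ n₂ off st base m₀ n P (m - 1)) ?_).mono le_rfl
        fun s'' h => ⟨m - 1, by omega, h⟩
      have h7' : s'.reg 7 = 1 := hs'.2.2.2.2.2.2.2.1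
      simp only [wp, nextRound, State.reg_set, h7', h10', h16', if_false, Nat.reduceEqDiff]
      refine ⟨by omega, by omega, hs'.congr fun r hr9 => ?_, ?_, ?_, ?_, ?_⟩
      · have : r ≠ 10 ∧ r ≠ 16 := by omega
        simp [this]
      · simp
      · simp; omega
      · simpa using hP'
      · simpa using hm₀'
    · rintro m s ⟨hs, h16, h10, hP, hm₀⟩ hc
      have h7 : s.reg 7 = 1 := hs.2.2.2.2.2.2.2.1
      rw [h7, h16] at hc
      have : s.reg 10 = n := by omega
      exact ⟨hs, this ▸ hP, hm₀⟩

/-- There are n₁ rounds, each with at most n₂ constant-time extensions of the window to the left. -/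
theorem runs_closestTables (hL : Layout n₁ n₂ off st base S.length W cell) {m₀ : ℕ → ℕ}
    {s : State} (hs : Ready n₁ n₂ off st base s) (hm₀ : ∀ x < base, s.mem x = m₀ x) :
    Runs S W closestTables s (100 * (n₁ * n₂)) fun s' =>
      Ready n₁ n₂ off st base s' ∧ Filled f n₁ n₂ (fun _ _ => True) s'.mem ∧
        ∀ x < base, s'.mem x = m₀ x := by
  have hpos := Nat.mul_pos hL.n₁_pos hL.n₂_pos
  have hn : n₁ ≤ n₁ * n₂ := Nat.le_mul_of_pos_right _ hL.n₂_pos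
  refine (runs_rounds hf hL (P := fun k mem => Filled f n₁ n₂ (fun i l => i + l < k) mem)
    (n := n₁) (B := 7 + ((18 + 1) * n₂ + 1)) (by decide) hs hs.1 hn
    (fun i l _ _ h => by simp at h) hm₀ ?_).mono ?_ ?_
  · intro k c s hk hs h16 h10 hP hm₀
    refine Runs.seq (R := ClosestInv f n₁ n₂ off st base m₀ k c (min (k + 1) n₂)) ?_ ?_
    · refine (Runs.of_wp hf ?_).mono (show closestInit.cost ≤ 7 by decide) fun _ => id
      obtain ⟨r0, r1, r2, r3, r4, r5, r6, r7, r8⟩ := id hs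
      have h1 := hL.n₁_le
      have h2 := hL.len_le
      have h3 := hL.bound
      have h4 : n₂ ≤ n₁ * n₂ := Nat.le_mul_of_pos_left _ hL.n₁_pos
      simp only [closestInit, block, wp, move, State.reg_set, h10, r8, r7, r1, if_false, if_true, Nat.reduceEqDiff, Nat.add_zero]
      refine ⟨by omega, by omega, by omega, by omega, fun h => ?_, fun h => ⟨by omega, ?_⟩⟩
      all_goals
        refine ⟨hs.congr fun r hr9 => ?_, ?_, ?_, ?_, ?_, ?_, ?_, ?_, ?_⟩
        · have : r ≠ 11 ∧ r ≠ 12 ∧ r ≠ 13 ∧ r ≠ 15 := by omega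
          simp [this]
        · simp [h10]
        · simp [h16]
        · simp; omega
        · simp
        · simpa using closest_empty _ f k
        · simpa using closest_empty _ f k
        · simpa using hP
        · simpa using hm₀
    · intro s' hs'
      refine (Runs.loop (B := 18) (ClosestInv f n₁ n₂ off st base m₀ k c) ?_ ?_ _ s' hs').mono
        (by gcongr; exact min_le_right _ _) fun _ => id
      · intro m s h hc
        have hc' : 0 < m := by
          have h7 : s.reg 7 = 1 := h.1.2.2.2.2.2.2.2.1
          have h15 := h.2.2.2.1
          omega
        exact (Runs.of_wp hf (wp_closestBody hL hk hc' h)).mono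
          (show closestBody.cost ≤ 18 by decide) fun s'' h => ⟨m - 1, by omega, h⟩
      · rintro m s ⟨hs, h10, h16, h15, hl, hp, hq, hF, h0⟩ hc
        have h7 : s.reg 7 = 1 := hs.2.2.2.2.2.2.2.1
        refine ⟨hs, h16, h10, fun i l hi hl' hD => hF i l hi hl' ?_, h0⟩
        omega
  · have e : (7 + ((18 + 1) * n₂ + 1) + 2 + 1) * n₁ = 19 * (n₁ * n₂) + 11 * n₁ := by ring
    omega
  · rintro s' ⟨h1, h2, h3⟩
    exact ⟨h1, fun i l hi hl _ => h2 i l hi hl hi, h3⟩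

end Correctness

/-! ### The sweep along the diagonals. -/

section Correctness

variable {α : Type*} [LinearOrder α] {f : ℕ → α} {n₁ n₂ off st base len W : ℕ}
  {cell : ℕ → ℕ → Prop}

/-- Register `15` is a sticky flag: a disagreement sets it and nothing here clears it, so
consecutive checks accumulate. -/
theorem wp_agree {s : State} {Q : State → Prop} {a b c d : ℕ} (hW : 1 < W)
    (ha : s.reg a < len) (hb : s.reg b < len) (hc : s.reg c < len) (hd : s.reg d < len)
    (hQ : ∀ s' : State, s'.mem = s.mem → (∀ r, r ≠ 15 → s'.reg r = s.reg r) →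
      ((f (s.reg a) ≤ f (s.reg b) ↔ f (s.reg c) ≤ f (s.reg d)) → s'.reg 15 = s.reg 15) →
      (¬ (f (s.reg a) ≤ f (s.reg b) ↔ f (s.reg c) ≤ f (s.reg d)) → s'.reg 15 = 1) → Q s') :
    wp f len W (agree a b c d) Q s := by
  have hskip : (f (s.reg a) ≤ f (s.reg b) ↔ f (s.reg c) ≤ f (s.reg d)) → Q s := fun h =>
    hQ s rfl (fun _ _ => rfl) (fun _ => rfl) fun h' => absurd h h'
  have hset : ¬ (f (s.reg a) ≤ f (s.reg b) ↔ f (s.reg c) ≤ f (s.reg d)) → Q (s.set 15 1) :=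
    fun h => hQ _ rfl (fun r hr => by simp [hr]) (fun h' => absurd h' h) fun _ => by simp
  simp only [agree, wp]
  refine ⟨ha, hb, fun h1 => ⟨hc, hd, fun h2 => hskip ?_, fun h2 => ⟨hW, hset ?_⟩⟩,
    fun h1 => ⟨hc, hd, fun h2 => ⟨hW, hset ?_⟩, fun h2 => hskip ?_⟩⟩ <;> tauto

theorem wp_checkTable {s : State} {Q : State → Prop} {b p x y q : ℕ} (hW : 1 < W)
    (hlen : len ≤ W) (ha : s.reg 21 + s.reg b < W) (hp : s.mem (s.reg 21 + s.reg b) = p)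
    (hx : s.reg 22 = x) (hy : s.reg 24 = y) (hq : p - s.reg 11 + s.reg 23 = q) (hpl : p < len)
    (hxl : x < len) (hyl : y < len) (hql : q < len)
    (hQ : ∀ s' : State, s'.mem = s.mem → (∀ r < 25, r ≠ 15 → s'.reg r = s.reg r) →
      (SameOrder f x p y q → s'.reg 15 = s.reg 15) →
      (¬ SameOrder f x p y q → s'.reg 15 = 1) → Q s') :
    wp f len W (checkTable b) Q s := by
  simp only [checkTable, block, wp, State.reg_set, State.mem_set, hp, if_true, if_false,
    Nat.reduceEqDiff, hq]
  refine ⟨ha, ha, by omega, by omega, by omega, ?_⟩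
  refine wp_agree hW (by simpa) (by simpa [hx]) (by simpa) (by simpa [hy]) ?_
  intro s₁ m1 f1 e1 n1
  refine wp_agree hW (by simpa [f1, hx]) (by simpa [f1]) (by simpa [f1, hy]) (by simpa [f1]) ?_
  intro s₂ m2 f2 e2 n2
  simp only [State.reg_set, if_true, if_false, Nat.reduceEqDiff, hx, hy, f1, ne_eq,
    not_false_eq_true] at e1 n1 e2 n2
  refine hQ s₂ (m2.trans m1) (fun r hr h15 => ?_) (fun h => ?_) (fun h => ?_)
  · rw [f2 r h15, f1 r h15]
    have : r ≠ 25 ∧ r ≠ 26 := by omega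
    simp [this]
  · rw [e2 h.2, e1 h.1]
  · by_cases h1 : f p ≤ f x ↔ f q ≤ f y
    · exact n2 fun h2 => h ⟨h1, h2⟩
    · by_cases h2 : f x ≤ f p ↔ f y ≤ f q
      · exact (e2 h2).trans (n1 h1)
      · exact n2 h2

/-- `Iso.succ_iff` with the tabulated closest positions. A missing one is stored as the new position
itself, whose comparison with itself always agrees. -/
theorem wp_checkExtension (hL : Layout n₁ n₂ off st base len W cell) {s : State}
    {Q : State → Prop} {i j l : ℕ} (hs : Ready n₁ n₂ off st base s)
    (hF : Filled f n₁ n₂ (fun _ _ => True) s.mem) (h11 : s.reg 11 = i) (h12 : s.reg 12 = j)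
    (h13 : s.reg 13 = l) (h15 : s.reg 15 = 0) (hi : i + l < n₁) (hj : j + l < n₂)
    (hiso : Iso f i (off + j) l)
    (hQ : ∀ s' : State, s'.mem = s.mem → (∀ r < 21, r ≠ 15 → s'.reg r = s.reg r) →
      (Iso f i (off + j) (l + 1) → s'.reg 15 = 0) →
      (¬ Iso f i (off + j) (l + 1) → s'.reg 15 = 1) → Q s') :
    wp f len W checkExtension Q s := by
  obtain ⟨r0, r1, r2, r3, r4, r5, r6, r7, r8⟩ := hs
  obtain ⟨hn₁, hn₂, hn₁', hend, hlen, hbase, hW, -, -⟩ := hL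
  obtain ⟨hp, hq⟩ := hF i l hi (by omega) trivial
  have hlt := mul_add_lt (show i < n₁ by omega) (show l < n₂ by omega)
  have hiff := hiso.succ_iff hp hq
  generalize ep : s.mem (i * n₂ + l + (n₁ * n₂ + 1)) = p at hp hiff
  generalize eq : s.mem (i * n₂ + l + (2 * (n₁ * n₂) + 1)) = q at hq hiff
  have hpl := hp.le
  have hql := hq.le
  simp only [checkExtension, block, wp, State.reg_set, h11, h12, h13, r1, r2, if_true, if_false,
    Nat.reduceEqDiff]
  refine ⟨by omega, by omega, by omega, by omega, by omega, ?_⟩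
  refine wp_checkTable (p := p) (q := p - i + (off + j)) (x := i + l) (y := off + j + l)
    (by omega) (by omega) (by simp [r5]; omega) (by simpa [r5] using ep) (by simp) (by simp)
    (by simp [h11]) (by omega) (by omega) (by omega) (by omega) ?_
  intro s₁ m1 f1 e1 n1
  have f1' : ∀ r < 21, r ≠ 15 → s₁.reg r = s.reg r := fun r hr h => by
    rw [f1 r (by omega) h]
    have : r ≠ 21 ∧ r ≠ 22 ∧ r ≠ 23 ∧ r ≠ 24 := by omega
    simp [this]
  have e21 : s₁.reg 21 = i * n₂ + l := by simp [f1]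
  have e23 : s₁.reg 23 = off + j := by simp [f1]
  refine wp_checkTable (p := q) (q := q - i + (off + j)) (x := i + l) (y := off + j + l)
    (by omega) (by omega) (by rw [e21, f1' _ (by decide) (by decide), r6]; omega)
    (by rw [e21, f1' _ (by decide) (by decide), r6, m1]; exact eq) (by simp [f1]) (by simp [f1])
    (by rw [e23, f1' _ (by decide) (by decide), h11]) (by omega) (by omega) (by omega) (by omega) ?_
  intro s₂ m2 f2 e2 n2
  simp only [State.reg_set, Nat.reduceEqDiff, if_false, h15] at e1
  refine hQ s₂ (m2.trans m1) (fun r hr h => ?_) (fun h => ?_) (fun h => ?_)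
  · rw [f2 r (by omega) h, f1' r hr h]
  · rw [e2 (hiff.1 h).2, e1 (hiff.1 h).1]
  · by_cases h2 : SameOrder f (i + l) q (off + j + l) (q - i + (off + j))
    · rw [e2 h2]
      exact n1 fun h1 => h (hiff.2 ⟨h1, h2⟩)
    · exact n2 h2

/-- The invariant of the sweep along the diagonal that begins at `(i₀, j₀)`. -/
def DiagonalInv (f : ℕ → α) (n₁ n₂ off st base : ℕ) (cell : ℕ → ℕ → Prop) (m₀ : ℕ → ℕ)
    (D : ℕ → ℕ → Prop) (i₀ j₀ k c m : ℕ) (s : State) : Prop :=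
  -- Register `14` is the greatest length that fits at the current pair and `13` the length matched
  -- so far; the measure is twice the former minus the latter.
  Ready n₁ n₂ off st base s ∧ s.reg 10 = k ∧ s.reg 16 = c ∧ 2 * s.reg 14 = m + s.reg 13 ∧
    s.reg 13 ≤ s.reg 14 ∧ s.reg 11 + s.reg 14 ≤ n₁ ∧ s.reg 12 + s.reg 14 ≤ n₂ ∧
    (s.reg 11 + s.reg 14 = n₁ ∨ s.reg 12 + s.reg 14 = n₂) ∧ i₀ ≤ s.reg 11 ∧
    s.reg 11 + j₀ = i₀ + s.reg 12 ∧ Iso f (s.reg 11) (off + s.reg 12) (s.reg 13) ∧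
    Filled f n₁ n₂ (fun _ _ => True) s.mem ∧
    Computed f n₁ n₂ off st base cell
      (fun a b => D a b ∨ i₀ ≤ a ∧ a < s.reg 11 ∧ a + j₀ = i₀ + b) s.mem ∧
    ∀ x < base, s.mem x = m₀ x

/-- The answer is written below both tables and, by injectivity of the layout, onto no other answer;
`Iso.tail` restores the invariant at the next pair. -/
theorem wp_advance (hL : Layout n₁ n₂ off st base len W cell) {m₀ : ℕ → ℕ}
    {D : ℕ → ℕ → Prop} {i₀ j₀ k c m : ℕ} {s : State}
    (hcell : ∀ a b, i₀ ≤ a → a + j₀ = i₀ + b → a < n₁ → b < n₂ → cell a b)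
    (h : DiagonalInv f n₁ n₂ off st base cell m₀ D i₀ j₀ k c m s) (hpos : 0 < s.reg 14)
    (hlce : IsLCE f n₁ n₂ off (s.reg 11) (s.reg 12) (s.reg 13)) :
    wp f len W advance (fun s' => ∃ m' < m,
      DiagonalInv f n₁ n₂ off st base cell m₀ D i₀ j₀ k c m' s') s := by
  obtain ⟨hs, h10, h16, hm, hlr, hir, hjr, hend, hi₀, hdiag, hiso, hF, hC, h0⟩ := h
  generalize h11 : s.reg 11 = i at *
  generalize h12 : s.reg 12 = j at *
  generalize h13 : s.reg 13 = l at *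
  generalize h14 : s.reg 14 = rem at *
  obtain ⟨r0, r1, r2, r3, r4, r5, r6, r7, r8⟩ := id hs
  obtain ⟨hn₁, hn₂, hn₁', hend', hlen, hbase, hW, hcl, hinj⟩ := hL
  have hc := hcell i j hi₀ hdiag (by omega) (by omega)
  have hle := hcl i j hc
  simp only [advance, block, wp, State.reg_set, State.reg_put, h11, h12, h13, h14, r3, r4, r7,
    if_true, if_false, Nat.reduceEqDiff]
  refine ⟨by omega, by omega, by omega, by omega, by omega, by omega, by omega, by omega,
    by omega, 2 * (rem - 1) - (l - 1), by omega, hs.congr fun r hr9 => ?_, ?_⟩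
  · have : r ≠ 11 ∧ r ≠ 12 ∧ r ≠ 13 ∧ r ≠ 14 ∧ r ≠ 21 := by omega
    simp [this]
  · simp only [State.reg_set, State.reg_put, State.mem_set, if_true, if_false, Nat.reduceEqDiff,
      h10, h16]
    refine ⟨trivial, trivial, by omega, by omega, by omega, by omega, by omega, by omega,
      by omega, hiso.tail, ?_, ?_, ?_⟩
    · intro a b ha hb _
      have : a * n₂ + b < n₁ * n₂ := mul_add_lt (by omega) hb
      have h1 : a * n₂ + b + (n₁ * n₂ + 1) ≠ i * st + j + base := by omega
      have h2 : a * n₂ + b + (2 * (n₁ * n₂) + 1) ≠ i * st + j + base := by omega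
      simpa [h1, h2] using hF a b ha hb trivial
    · intro a b ha hb hab hD
      by_cases heq : a = i ∧ b = j
      · simpa [heq] using hlce
      · have h1 : a * st + b ≠ i * st + j := fun h => heq (hinj a b i j hab hc h)
        have := hC a b ha hb hab (hD.imp_right fun ⟨h1, h2, h3⟩ => ⟨h1, by omega, h3⟩)
        simpa [h1] using this
    · intro x hx
      have h1 : x ≠ i * st + j + base := by omega
      simpa [h1] using h0 x hx

theorem wp_diagonalBody (hL : Layout n₁ n₂ off st base len W cell) {m₀ : ℕ → ℕ}
    {D : ℕ → ℕ → Prop} {i₀ j₀ k c m : ℕ} {s : State}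
    (hcell : ∀ a b, i₀ ≤ a → a + j₀ = i₀ + b → a < n₁ → b < n₂ → cell a b)
    (h : DiagonalInv f n₁ n₂ off st base cell m₀ D i₀ j₀ k c m s) (hpos : 0 < s.reg 14) :
    wp f len W diagonalBody (fun s' => ∃ m' < m,
      DiagonalInv f n₁ n₂ off st base cell m₀ D i₀ j₀ k c m' s') s := by
  have h' := h
  obtain ⟨hs, h10, h16, hm, hlr, hir, hjr, hend, hi₀, hdiag, hiso, hF, hC, h0⟩ := h'
  obtain ⟨r0, r1, r2, r3, r4, r5, r6, r7, r8⟩ := id hs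
  have hWn := hL.bound
  have hlen := hL.len_le
  have hn₁ := hL.n₁_le
  have hNpos := Nat.mul_pos hL.n₁_pos hL.n₂_pos
  -- the state after the check
  have next : ∀ s' : State, s'.mem = s.mem → (∀ r < 20, r ≠ 15 → s'.reg r = s.reg r) →
      s'.reg 20 = s.reg 13 + 1 →
      (s.reg 13 < s.reg 14 ∧ Iso f (s.reg 11) (off + s.reg 12) (s.reg 13 + 1) →
        s'.reg 15 = 0) →
      (¬ (s.reg 13 < s.reg 14 ∧ Iso f (s.reg 11) (off + s.reg 12) (s.reg 13 + 1)) →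
        s'.reg 15 = 1) →
      wp f len W (.branch (.le 7 15) advance (move 13 20)) (fun s' => ∃ m' < m,
        DiagonalInv f n₁ n₂ off st base cell m₀ D i₀ j₀ k c m' s') s' := by
    intro s' hmem hreg h20 e0 e1
    have hs' : Ready n₁ n₂ off st base s' := hs.congr fun r hr => hreg r (by omega) (by omega)
    have g7 : s'.reg 7 = 1 := hs'.2.2.2.2.2.2.2.1
    have g8 : s'.reg 8 = 0 := hs'.2.2.2.2.2.2.2.2
    have g10 := hreg 10 (by decide) (by decide)
    have g11 := hreg 11 (by decide) (by decide)
    have g12 := hreg 12 (by decide) (by decide)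
    have g13 := hreg 13 (by decide) (by decide)
    have g14 := hreg 14 (by decide) (by decide)
    have g16 := hreg 16 (by decide) (by decide)
    -- Since register `14` exhausts one of the two strings, a failed extension means that the
    -- current length is maximal.
    have hsub : ¬ (s.reg 13 < s.reg 14 ∧ Iso f (s.reg 11) (off + s.reg 12) (s.reg 13 + 1)) →
        IsLCE f n₁ n₂ off (s.reg 11) (s.reg 12) (s.reg 13) := fun hn =>
      ⟨⟨by omega, by omega, hiso⟩, fun ⟨h1, h2, h3⟩ => hn ⟨by omega, h3⟩⟩
    simp only [wp, move, g7]
    refine ⟨fun hc => ?_, fun hc => ?_⟩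
    · refine wp_advance hL hcell (m := m) ?_ (by omega) ?_
      · rw [DiagonalInv, g10, g11, g12, g13, g14, g16, hmem]
        exact ⟨hs', h.2⟩
      · rw [g11, g12, g13]
        exact hsub fun hn => by have := e0 hn; omega
    · have hn := not_not.1 fun hn => hc (e1 hn).ge
      rw [g8, h20]
      refine ⟨by omega, m - 1, by omega, hs'.congr fun r hr9 => ?_, ?_⟩
      · have : r ≠ 13 := by omega
        simp [this]
      · simp only [State.reg_set, State.mem_set, if_true, if_false, Nat.reduceEqDiff, g10, g11,
          g12, g14, g16, h10, h16, hmem]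
        exact ⟨trivial, trivial, by omega, by omega, hir, hjr, hend, hi₀, hdiag, hn.2, hF, hC, h0⟩
  -- Restricting `wp.eq_9` to `a := 20` leaves the last branch folded, the form that `next` proves.
  simp only [diagonalBody, block, wp.eq_8, wp.eq_2, wp.eq_3, wp.eq_9 (a := 20), State.reg_set, r7, if_true, if_false,
    Nat.reduceEqDiff]
  refine ⟨by omega, by omega, fun hc => ?_, fun hc => ⟨by omega, ?_⟩⟩
  · refine wp_checkExtension hL (i := s.reg 11) (j := s.reg 12) (l := s.reg 13)
      (hs.congr fun r hr9 => ?_) hF (by simp) (by simp) (by simp) (by simp) (by omega) (by omega)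
      hiso ?_
    · have : r ≠ 15 ∧ r ≠ 20 := by omega
      simp [this]
    · intro s' hmem hreg e0 e1
      refine next s' hmem (fun r hr h15 => ?_) ?_ (fun hn => e0 hn.2)
        fun hn => e1 fun hn' => hn ⟨by omega, hn'⟩
      · rw [hreg r (by omega) h15]
        have : r ≠ 20 := by omega
        simp [this, h15]
      · rw [hreg 20 (by decide) (by decide)]
        simp
  · refine next _ rfl (fun r hr h15 => ?_) (by simp) (fun hn => by omega) (fun _ => by simp)
    have : r ≠ 20 := by omega
    simp [this, h15]

variable {S : List α} (hf : ∀ i < S.length, S[i]? = some (f i))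
include hf

theorem runs_diagonal (hL : Layout n₁ n₂ off st base S.length W cell) {m₀ : ℕ → ℕ}
    {D : ℕ → ℕ → Prop} {i₀ j₀ k c : ℕ} {s : State}
    (hcell : ∀ a b, i₀ ≤ a → a + j₀ = i₀ + b → a < n₁ → b < n₂ → cell a b)
    (hs : Ready n₁ n₂ off st base s) (h10 : s.reg 10 = k) (h16 : s.reg 16 = c)
    (h11 : s.reg 11 = i₀) (h12 : s.reg 12 = j₀) (hi : i₀ ≤ n₁) (hj : j₀ ≤ n₂)
    (hF : Filled f n₁ n₂ (fun _ _ => True) s.mem)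
    (hC : Computed f n₁ n₂ off st base cell D s.mem) (hm₀ : ∀ x < base, s.mem x = m₀ x) :
    Runs S W diagonal s (100 * min (n₁ - i₀) (n₂ - j₀) + 10) fun s' =>
      Ready n₁ n₂ off st base s' ∧ s'.reg 16 = c ∧ s'.reg 10 = k ∧
        (Filled f n₁ n₂ (fun _ _ => True) s'.mem ∧ Computed f n₁ n₂ off st base cell
          (fun a b => D a b ∨ i₀ ≤ a ∧ a + j₀ = i₀ + b) s'.mem) ∧ ∀ x < base, s'.mem x = m₀ x := by
  have hc : diagonalInit.cost = 5 := by decide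
  have hc' : diagonalBody.cost ≤ 37 := by decide
  have hWn := hL.bound
  have hlen := hL.len_le
  have hn₁ := hL.n₁_le
  have hn₂ := hL.end_le
  have hNpos := Nat.mul_pos hL.n₁_pos hL.n₂_pos
  -- The sweep starts with matched length `0`, so the initial measure is twice the length of the
  -- diagonal.
  refine ((Runs.of_wp hf (Q := DiagonalInv f n₁ n₂ off st base cell m₀ D i₀ j₀ k c
    (2 * min (n₁ - i₀) (n₂ - j₀))) ?_).seq fun s' hs' => Runs.loop (B := 37)
      (DiagonalInv f n₁ n₂ off st base cell m₀ D i₀ j₀ k c) ?_ ?_ _ s' hs').mono ?_ fun _ => id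
  · obtain ⟨r0, r1, r2, r3, r4, r5, r6, r7, r8⟩ := id hs
    simp only [diagonalInit, block, wp, move, State.reg_set, r0, r1, r8, h11, h12, if_true,
      if_false, Nat.reduceEqDiff, Nat.add_zero]
    refine ⟨by omega, by omega, by omega, fun h => ?_, fun h => ⟨by omega, ?_⟩⟩
    all_goals
      refine ⟨hs.congr fun r hr9 => ?_, ?_⟩
      · have : r ≠ 13 ∧ r ≠ 14 ∧ r ≠ 20 := by omega
        simp [this]
      · simp only [State.reg_set, State.mem_set, h10, h11, h12, h16, if_true, if_false,
          Nat.reduceEqDiff]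
        refine ⟨trivial, trivial, by omega, by omega, by omega, by omega, by omega, le_rfl,
          trivial, fun u v hu => by omega, hF, fun a b ha hb hab hD => ?_, hm₀⟩
        exact hC a b ha hb hab (hD.resolve_right (by omega))
  · intro m s h hc
    refine (Runs.of_wp hf (wp_diagonalBody hL hcell h ?_)).mono hc' fun _ => id
    have h7 : s.reg 7 = 1 := h.1.2.2.2.2.2.2.2.1
    omega
  · rintro m s ⟨hs, h10, h16, hm, hlr, hir, hjr, hend, hi₀, hdiag, hiso, hF, hC, h0⟩ hc
    have h7 : s.reg 7 = 1 := hs.2.2.2.2.2.2.2.1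
    refine ⟨hs, h16, h10, ⟨hF, fun a b ha hb hab hD => hC a b ha hb hab ?_⟩, h0⟩
    exact hD.imp_right fun ⟨h1, h2⟩ => ⟨h1, by omega, h2⟩
  · rw [hc]
    omega

/-- There are n₂ diagonals of length at most n₁. The diagonal from `(0, k)` adds the pairs with `b =
a + k`. -/
theorem runs_upperDiagonals (hL : Layout n₁ n₂ off st base S.length W cell) {m₀ : ℕ → ℕ}
    {s : State} (hcell : ∀ a b, a ≤ b → a < n₁ → b < n₂ → cell a b)
    (hs : Ready n₁ n₂ off st base s) (hF : Filled f n₁ n₂ (fun _ _ => True) s.mem)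
    (hm₀ : ∀ x < base, s.mem x = m₀ x) :
    Runs S W upperDiagonals s (150 * (n₁ * n₂)) fun s' =>
      Ready n₁ n₂ off st base s' ∧ (Filled f n₁ n₂ (fun _ _ => True) s'.mem ∧
        Computed f n₁ n₂ off st base cell (fun a b => a ≤ b) s'.mem) ∧
        ∀ x < base, s'.mem x = m₀ x := by
  have hNpos := Nat.mul_pos hL.n₁_pos hL.n₂_pos
  have hn : n₂ ≤ n₁ * n₂ := Nat.le_mul_of_pos_left _ hL.n₁_pos
  have hWn := hL.bound
  refine (runs_rounds hf hL (P := fun k mem => Filled f n₁ n₂ (fun _ _ => True) mem ∧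
    Computed f n₁ n₂ off st base cell (fun a b => a ≤ b ∧ b < a + k) mem)
    (n := n₂) (B := 2 + (100 * n₁ + 10)) (by decide) hs hs.2.1 hn
    ⟨hF, fun a b _ _ _ h => by omega⟩ hm₀ ?_).mono ?_ ?_
  · rintro k c s hk hs h16 h10 ⟨hF, hC⟩ hm₀
    refine Runs.seq (R := fun s' => s' = (s.set 11 0).set 12 k) (Runs.of_wp hf ?_) ?_
    · have h8 : s.reg 8 = 0 := hs.2.2.2.2.2.2.2.2
      simp only [wp, move, State.reg_set, h10, h8, if_false, Nat.reduceEqDiff, Nat.add_zero]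
      exact ⟨by omega, by omega, trivial⟩
    · rintro _ rfl
      refine (runs_diagonal hf hL (i₀ := 0) (j₀ := k) (k := k) (c := c) (m₀ := m₀)
        (D := fun a b => a ≤ b ∧ b < a + k)
        (fun a b _ h ha hb => hcell a b (by omega) ha hb) (hs.congr fun r hr9 => ?_) (by simpa)
        (by simpa) (by simp) (by simp) (by omega) (by omega) (by simpa) (by simpa)
        (by simpa)).mono ?_ ?_
      · have : r ≠ 11 ∧ r ≠ 12 := by omega
        simp [this]
      · omega
      · rintro s' ⟨h1, h2, h3, ⟨h4, h5⟩, h6⟩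
        refine ⟨h1, h2, h3, ⟨h4, fun a b ha hb hab hD => h5 a b ha hb hab ?_⟩, h6⟩
        omega
  · have e : (2 + (100 * n₁ + 10) + 2 + 1) * n₂ = 100 * (n₁ * n₂) + 15 * n₂ := by ring
    omega
  · rintro s' ⟨h1, ⟨h2, h3⟩, h4⟩
    exact ⟨h1, ⟨h2, fun a b ha hb hab h => h3 a b ha hb hab ⟨h, by omega⟩⟩, h4⟩

theorem runs_lowerDiagonals (hL : Layout n₁ n₂ off st base S.length W cell) {m₀ : ℕ → ℕ}
    {s : State} (hcell : ∀ a b, b ≤ a → a < n₁ → b < n₂ → cell a b)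
    (hs : Ready n₁ n₂ off st base s) (hF : Filled f n₁ n₂ (fun _ _ => True) s.mem)
    (hC : Computed f n₁ n₂ off st base cell (fun a b => a ≤ b) s.mem)
    (hm₀ : ∀ x < base, s.mem x = m₀ x) :
    Runs S W lowerDiagonals s (150 * (n₁ * n₂)) fun s' =>
      Ready n₁ n₂ off st base s' ∧ (Filled f n₁ n₂ (fun _ _ => True) s'.mem ∧
        Computed f n₁ n₂ off st base cell (fun _ _ => True) s'.mem) ∧
        ∀ x < base, s'.mem x = m₀ x := by
  have hNpos := Nat.mul_pos hL.n₁_pos hL.n₂_pos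
  have hn : n₁ ≤ n₁ * n₂ := Nat.le_mul_of_pos_right _ hL.n₂_pos
  have hWn := hL.bound
  refine (runs_rounds hf hL (P := fun k mem => Filled f n₁ n₂ (fun _ _ => True) mem ∧
    -- The second alternative keeps the upper answers; round `0` recomputes the main diagonal.
    Computed f n₁ n₂ off st base cell (fun a b => a < b + k ∨ a ≤ b) mem)
    (n := n₁) (B := 2 + (100 * n₂ + 10)) (by decide) hs hs.1 hn
    ⟨hF, fun a b ha hb hab h => hC a b ha hb hab (by omega)⟩ hm₀ ?_).mono ?_ ?_
  · rintro k c s hk hs h16 h10 ⟨hF, hC⟩ hm₀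
    refine Runs.seq (R := fun s' => s' = (s.set 11 k).set 12 0) (Runs.of_wp hf ?_) ?_
    · have h8 : s.reg 8 = 0 := hs.2.2.2.2.2.2.2.2
      simp only [wp, move, h10, h8, Nat.add_zero]
      exact ⟨by omega, by omega, trivial⟩
    · rintro _ rfl
      refine (runs_diagonal hf hL (i₀ := k) (j₀ := 0) (k := k) (c := c) (m₀ := m₀)
        (D := fun a b => a < b + k ∨ a ≤ b)
        (fun a b _ h ha hb => hcell a b (by omega) ha hb) (hs.congr fun r hr9 => ?_) (by simpa)
        (by simpa) (by simp) (by simp) (by omega) (by omega) (by simpa) (by simpa)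
        (by simpa)).mono ?_ ?_
      · have : r ≠ 11 ∧ r ≠ 12 := by omega
        simp [this]
      · omega
      · rintro s' ⟨h1, h2, h3, ⟨h4, h5⟩, h6⟩
        refine ⟨h1, h2, h3, ⟨h4, fun a b ha hb hab hD => h5 a b ha hb hab ?_⟩, h6⟩
        omega
  · have e : (2 + (100 * n₂ + 10) + 2 + 1) * n₁ = 100 * (n₁ * n₂) + 15 * n₁ := by ring
    omega
  · rintro s' ⟨h1, ⟨h2, h3⟩, h4⟩
    exact ⟨h1, ⟨h2, fun a b ha hb hab h => h3 a b ha hb hab (.inl (by omega))⟩, h4⟩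

end Correctness

/-! ### Assembly: strings, memory layouts and complete programs. -/

section Main

variable {α : Type*}

/-- A total character function avoids options; its values beyond the string are irrelevant, as
programs read only valid positions. -/
theorem exists_characters {S : List α} (hS : S ≠ []) :
    ∃ f : ℕ → α, ∀ i < S.length, S[i]? = some (f i) :=
  ⟨fun i => S.getD i (S.head hS), fun i hi => by simp [hi]⟩

variable [LinearOrder α]

/-- The length bounds keep the first window from running into the second string of the
concatenation. -/
theorem isOpLCE_of_isLCE {f : ℕ → α} {S₁ S₂ : List α}
    (hf : ∀ i < (S₁ ++ S₂).length, (S₁ ++ S₂)[i]? = some (f i)) {i₁ i₂ v : ℕ} (h₁ : 1 ≤ i₁)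
    (h₂ : 1 ≤ i₂) (h : IsLCE f S₁.length S₂.length S₁.length (i₁ - 1) (i₂ - 1) v) :
    IsOpLCE S₁ S₂ i₁ i₂ v := by
  rw [List.length_append] at hf
  have e : ∀ l, i₁ + l ≤ S₁.length + 1 → i₂ + l ≤ S₂.length + 1 →
      (OrderIsomorphic (substring S₁ i₁ l) (substring S₂ i₂ l) ↔
        Iso f (i₁ - 1) (S₁.length + (i₂ - 1)) l) := by
    intro l hl₁ hl₂
    refine orderIsomorphic_iff_iso (by simp [substring]; omega) (by simp [substring]; omega) ?_ ?_
    · intro u hu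
      rw [substring, List.getElem?_take_of_lt hu, List.getElem?_drop, ← hf _ (by omega),
        List.getElem?_append_left (by omega)]
    · intro u hu
      rw [substring, List.getElem?_take_of_lt hu, List.getElem?_drop, ← hf _ (by omega),
        List.getElem?_append_right (by omega)]
      congr 1
      omega
  unfold IsOpLCE
  convert h.isGreatest using 1
  ext l
  simp only [Set.mem_ofPred_eq]
  constructor
  · rintro ⟨h1, h2, h3⟩
    exact ⟨by omega, by omega, (e l h1 h2).1 h3⟩
  · rintro ⟨h1, h2, h3⟩
    exact ⟨by omega, by omega, (e l (by omega) (by omega)).2 h3⟩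

theorem isZEntry_of_isLCE {f : ℕ → α} {S : List α}
    (hf : ∀ i < S.length, S[i]? = some (f i)) {i k v : ℕ} (hi : 1 ≤ i) (hi' : i ≤ S.length)
    (hk : 1 ≤ k) (h : IsLCE f S.length S.length 0 (i - 1) (i - 1 + (k - 1)) v) :
    IsZEntry (suffixFrom S i) k v := by
  have hlen : (suffixFrom S i).length = S.length - (i - 1) := by simp [suffixFrom]
  have e : ∀ l, k + l ≤ (suffixFrom S i).length + 1 →
      (OrderIsomorphic (substring (suffixFrom S i) 1 l) (substring (suffixFrom S i) k l) ↔
        Iso f (i - 1) (0 + (i - 1 + (k - 1))) l) := by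
    intro l hl
    refine orderIsomorphic_iff_iso (by simp [substring]; omega) (by simp [substring]; omega) ?_ ?_
    all_goals
      intro u hu
      rw [substring, List.getElem?_take_of_lt hu, List.getElem?_drop, suffixFrom,
        List.getElem?_drop, ← hf _ (by omega)]
      congr 1
      omega
  unfold IsZEntry
  convert h.isGreatest using 1
  ext l
  simp only [Set.mem_ofPred_eq]
  constructor
  · rintro ⟨h1, h3⟩
    exact ⟨by omega, by omega, (e l h1).1 h3⟩
  · rintro ⟨h1, h2, h3⟩
    exact ⟨by omega, (e l (by omega)).2 h3⟩

theorem layout_lce {n₁ n₂ W : ℕ} (h₁ : 0 < n₁) (h₂ : 0 < n₂) (hW : 10 * (n₁ * n₂) ≤ W) :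
    Layout n₁ n₂ n₁ n₂ 1 (n₁ + n₂) W (fun i j => i < n₁ ∧ j < n₂) where
  n₁_pos := h₁
  n₂_pos := h₂
  n₁_le := by omega
  end_le := le_rfl
  len_le := by
    have h3 : n₁ ≤ n₁ * n₂ := Nat.le_mul_of_pos_right _ h₂
    have h4 : n₂ ≤ n₁ * n₂ := Nat.le_mul_of_pos_left _ h₁
    omega
  base_le := le_rfl
  bound := hW
  cell_le := fun i j h => mul_add_lt h.1 h.2
  cell_inj := fun i j i' j' h h' e => mul_add_inj h.2 h'.2 e

/-- Addresses with stride n - 1 become row-major addresses of `(i, j - i)`, which makes them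
injective above the main diagonal. -/
theorem mul_pred_add {n i j : ℕ} (hij : i ≤ j) (hj : j < n) :
    i * (n - 1) + j = i * n + (j - i) := by
  obtain ⟨m, rfl⟩ : ∃ m, n = m + 1 := ⟨n - 1, by omega⟩
  rw [Nat.add_sub_cancel, Nat.mul_succ]
  omega

theorem layout_zTables {n W : ℕ} (hn : 0 < n) (hW : 10 * (n * n) ≤ W) :
    Layout n n 0 (n - 1) 0 n W (fun i j => i ≤ j ∧ j < n) where
  n₁_pos := hn
  n₂_pos := hn
  n₁_le := le_rfl
  end_le := by omega
  len_le := by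
    have : n ≤ n * n := Nat.le_mul_of_pos_right _ hn
    omega
  base_le := by omega
  bound := hW
  cell_le := fun i j h => by
    have := mul_add_lt (show i < n by omega) (show j - i < n by omega)
    rw [mul_pred_add h.1 h.2]
    omega
  cell_inj := fun i j i' j' h h' e => by
    rw [mul_pred_add h.1 h.2, mul_pred_add h'.1 h'.2] at e
    obtain ⟨h1, h2⟩ := mul_add_inj (show j - i < n by omega) (show j' - i' < n by omega) e
    omega

variable {S : List α} {W : ℕ}

theorem runs_lceQuery {n₁ n₂ i₁ i₂ : ℕ} {mem : ℕ → ℕ} (h₁ : 1 ≤ i₁) (h₁' : i₁ ≤ n₁)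
    (h₂ : 1 ≤ i₂) (h₂' : i₂ ≤ n₂) (hS : S ≠ []) (hW : 10 * (n₁ * n₂) ≤ W) (h0 : mem 0 = n₂)
    (hmem : mem ((i₁ - 1) * n₂ + (i₂ - 1) + 1) < W) :
    Runs S W lceQuery (startState i₁ i₂ mem) 9 fun s =>
      s.mem = mem ∧ s.reg 0 = mem ((i₁ - 1) * n₂ + (i₂ - 1) + 1) := by
  obtain ⟨f, hf⟩ := exists_characters hS
  refine (Runs.of_wp hf ?_).mono (show lceQuery.cost ≤ 9 by decide) fun _ => id
  have hlt := mul_add_lt (show i₁ - 1 < n₁ by omega) (show i₂ - 1 < n₂ by omega)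
  have hle₁ : n₁ ≤ n₁ * n₂ := Nat.le_mul_of_pos_right _ (by omega)
  have hle₂ : n₂ ≤ n₁ * n₂ := Nat.le_mul_of_pos_left _ (by omega)
  simp only [lceQuery, block, wp, startState, State.reg_set, State.mem_set, if_true, if_false,
    Nat.reduceEqDiff, OfNat.ofNat_ne_zero, OfNat.ofNat_ne_one, one_ne_zero, zero_ne_one,
    OfNat.zero_ne_ofNat, OfNat.one_ne_ofNat, h0]
  exact ⟨by omega, by omega, by omega, by omega, by omega, by omega, by omega, by omega, by omega,
    by omega, hmem, trivial, trivial⟩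

variable {f : ℕ → α} (hf : ∀ i < S.length, S[i]? = some (f i))
include hf

theorem runs_lcePreprocessing {n₁ n₂ : ℕ} (hS : S.length = n₁ + n₂) (h₁ : 0 < n₁) (h₂ : 0 < n₂)
    (hW : 10 * (n₁ * n₂) ≤ W) :
    Runs S W lcePreprocessing (startState n₁ n₂ fun _ => 0) (500 * (n₁ * n₂)) fun s =>
      s.mem 0 = n₂ ∧
        ∀ i j, i < n₁ → j < n₂ → IsLCE f n₁ n₂ n₁ i j (s.mem (i * n₂ + j + 1)) := by
  have hL := layout_lce h₁ h₂ hW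
  rw [← hS] at hL
  have hN := Nat.mul_pos h₁ h₂
  have hle₁ : n₁ ≤ n₁ * n₂ := Nat.le_mul_of_pos_right _ h₂
  have hle₂ : n₂ ≤ n₁ * n₂ := Nat.le_mul_of_pos_left _ h₁
  refine (((Runs.of_wp hf (Q := fun s => Ready n₁ n₂ n₁ n₂ 1 s ∧ ∀ x < 1, s.mem x = n₂) ?_).seq
    fun s hs => (runs_closestTables hf hL hs.1 hs.2).seq fun s hs =>
      (runs_upperDiagonals hf hL (fun a b _ ha hb => ⟨ha, hb⟩) hs.1 hs.2.1 hs.2.2).seq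
        fun s hs => runs_lowerDiagonals hf hL (fun a b _ ha hb => ⟨ha, hb⟩) hs.1 hs.2.1.1
          hs.2.1.2 hs.2.2)).mono ?_ ?_
  · simp only [block, wp, move, startState, State.reg_set, State.mem_put,
      if_true, if_false, Nat.reduceEqDiff, Nat.add_zero, OfNat.ofNat_ne_zero, OfNat.ofNat_ne_one,
      one_ne_zero]
    refine ⟨by omega, by omega, by omega, by omega, by omega, by omega, by omega, by omega,
      by omega, by omega, by omega, ?_, fun x hx => ?_⟩
    · simp [Ready, two_mul]
    · simp; omega
  · simp only [Program.cost, block, move]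
    omega
  · rintro s ⟨-, ⟨-, hC⟩, h0⟩
    exact ⟨h0 0 (by decide), fun i j hi hj => hC i j hi hj ⟨hi, hj⟩ trivial⟩

theorem runs_zTables (hS : 0 < S.length) (hW : 10 * (S.length * S.length) ≤ W) :
    Runs S W zTables (startState S.length 0 fun _ => 0) (500 * (S.length * S.length)) fun s =>
      ∀ i j, i ≤ j → j < S.length →
        IsLCE f S.length S.length 0 i j (s.mem (i * S.length + (j - i))) := by
  have hL := layout_zTables hS hW
  generalize hn : S.length = n at *
  have hL' : Layout n n 0 (n - 1) 0 S.length W (fun i j => i ≤ j ∧ j < n) := by rwa [hn]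
  have hN := Nat.mul_pos hS hS
  have hle : n ≤ n * n := Nat.le_mul_of_pos_right _ hS
  rw [← hn] at hf
  refine (((Runs.of_wp hf (Q := Ready n n 0 (n - 1) 0) ?_).seq
    fun s hs => (runs_closestTables hf hL' (m₀ := fun _ => 0) hs fun x hx => absurd hx x.not_lt_zero).seq fun s hs =>
      (runs_upperDiagonals hf hL' (fun a b hab ha hb => ⟨hab, hb⟩) hs.1 hs.2.1
        hs.2.2))).mono ?_ ?_
  · simp only [block, wp, move, startState, State.reg_set,
      if_true, if_false, Nat.reduceEqDiff, Nat.add_zero, OfNat.ofNat_ne_zero, OfNat.ofNat_ne_one,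
      one_ne_zero, OfNat.zero_ne_ofNat, OfNat.one_ne_ofNat, zero_ne_one]
    refine ⟨by omega, by omega, by omega, by omega, by omega, by omega, by omega, by omega,
      by omega, by omega, ?_⟩
    simp [Ready, two_mul]
  · simp only [Program.cost, block, move]
    omega
  · rintro s ⟨-, ⟨-, hC⟩, h0⟩ i j hij hj
    rw [← mul_pred_add hij hj]
    exact hC i j (by omega) hj ⟨hij, hj⟩ hij

end Main

end OpLCE

theorem lemma3 :
    -- op-LCE queries: preprocessing in time and space `O(|S₁||S₂|)`, queries in time `O(1)`;
    -- a query leaves the memory as it was, so that arbitrarily many queries can follow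
    (∃ (pre query : OpLCE.Program) (C : ℕ),
      ∀ (α : Type*) [LinearOrder α] (S₁ S₂ : List α), S₁ ≠ [] → S₂ ≠ [] →
        ∃ (t : ℕ) (s : OpLCE.State),
          t ≤ C * (S₁.length * S₂.length) ∧
          OpLCE.Exec (S₁ ++ S₂) (C * (S₁.length * S₂.length)) (C * (S₁.length * S₂.length)) pre
            (OpLCE.startState S₁.length S₂.length (fun _ => 0)) t s ∧
          ∀ i₁ i₂ : ℕ, 1 ≤ i₁ → i₁ ≤ S₁.length → 1 ≤ i₂ → i₂ ≤ S₂.length →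
            ∃ (t' : ℕ) (s' : OpLCE.State),
              t' ≤ C ∧
              OpLCE.Exec (S₁ ++ S₂) (C * (S₁.length * S₂.length)) (C * (S₁.length * S₂.length))
                query (OpLCE.startState i₁ i₂ s.mem) t' s' ∧
              s'.mem = s.mem ∧
              OpLCE.IsOpLCE S₁ S₂ i₁ i₂ (s'.reg 0)) ∧
    -- the Z-tables of all suffixes in time `O(|S|²)`; the entry at `k` of the table of the
    -- suffix beginning at `i` is written to the memory cell `(i - 1) * |S| + (k - 1)`
    (∃ (prog : OpLCE.Program) (C : ℕ),
      ∀ (α : Type*) [LinearOrder α] (S : List α), S ≠ [] →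
        ∃ (t : ℕ) (s : OpLCE.State),
          t ≤ C * S.length ^ 2 ∧
          OpLCE.Exec S (C * S.length ^ 2) (C * S.length ^ 2) prog
            (OpLCE.startState S.length 0 (fun _ => 0)) t s ∧
          ∀ i k : ℕ, 1 ≤ i → i ≤ S.length → 1 ≤ k → k ≤ (OpLCE.suffixFrom S i).length →
            OpLCE.IsZEntry (OpLCE.suffixFrom S i) k
              (s.mem ((i - 1) * S.length + (k - 1)))) := by
  refine ⟨⟨OpLCE.lcePreprocessing, OpLCE.lceQuery, 500, ?_⟩, OpLCE.zTables, 500, ?_⟩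
  · intro α _ S₁ S₂ h₁ h₂
    obtain ⟨f, hf⟩ := OpLCE.exists_characters (S := S₁ ++ S₂) (by simp [h₁])
    have p₁ := List.length_pos_iff.2 h₁
    have p₂ := List.length_pos_iff.2 h₂
    have hW : 10 * (S₁.length * S₂.length) ≤ 500 * (S₁.length * S₂.length) := by omega
    obtain ⟨t, s, ht, hs, h0, hmem⟩ :=
      OpLCE.runs_lcePreprocessing hf List.length_append p₁ p₂ hW
    refine ⟨t, s, ht, hs, fun i₁ i₂ hi₁ hi₁' hi₂ hi₂' => ?_⟩
    have hlce := hmem (i₁ - 1) (i₂ - 1) (by omega) (by omega)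
    have hle : S₁.length ≤ S₁.length * S₂.length := Nat.le_mul_of_pos_right _ p₂
    -- The answer is at most |S₁|, so it fits into a word when the query loads it.
    have hlt := hlce.1.1
    obtain ⟨t', s', ht', hs', hm, hr⟩ := OpLCE.runs_lceQuery (S := S₁ ++ S₂) hi₁ hi₁' hi₂ hi₂'
      (by simp [h₁]) hW h0 (by omega)
    exact ⟨t', s', by omega, hs', hm, hr ▸ OpLCE.isOpLCE_of_isLCE hf hi₁ hi₂ hlce⟩
  · intro α _ S hS
    obtain ⟨f, hf⟩ := OpLCE.exists_characters hS
    have p := List.length_pos_iff.2 hS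
    rw [pow_two]
    obtain ⟨t, s, ht, hs, hmem⟩ := OpLCE.runs_zTables hf p
      (show 10 * (S.length * S.length) ≤ 500 * (S.length * S.length) by omega)
    refine ⟨t, s, ht, hs, fun i k hi hi' hk hk' => OpLCE.isZEntry_of_isLCE hf hi hi' hk ?_⟩
    have hlen : (OpLCE.suffixFrom S i).length = S.length - (i - 1) := by
      simp [OpLCE.suffixFrom]
    -- The entry at `k` compares the suffix at `i` with the one at `i + k - 1`; both indices are
    -- shifted to begin at `0`.
    have := hmem (i - 1) (i - 1 + (k - 1)) (by omega) (by omega)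
    rwa [Nat.add_sub_cancel_left] at this
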